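/- Let $n\ge 1$ and $\alpha\in(1/2,1)$. For $u:\mathbb R\to\mathbb R^n$ let $${}_{-\infty}D_t^{\alpha}u(t)=\frac{1}{\Gamma(1-\alpha)}\frac{d}{dt}\int_{-\infty}^{t}(t-\xi)^{-\alpha}u(\xi)\,d\xi$$ be the left Liouville–Weyl fractional derivative, let ${}_tD_\infty^\alpha$ be the right one, and let $H^{\alpha}(\mathbb R,\mathbb R^n)$ be the completion of $C_0^\infty(\mathbb R,\mathbb R^n)$ for the norm $\left(\|u\|_{L^2}^2+\|{}_{-\infty}D_t^{\alpha}u\|_{L^2}^2\right)^{1/2}$, with ${}_{-\infty}D_t^{\alpha}$ extended to it by continuity into $L^2$. Assume: (L) $L:\mathbb R\to\mathbb R^{n\times n}$ is continuous, $L(t)$ is symmetric and positive definite for every $t$, and there is a continuous $l:\mathbb R\to(0,\infty)$ with $l(t)\to+\infty$ as $|t|\to\infty$ and $(L(t)x,x)\ge l(t)|x|^2$ for all $t\in\mathbb R$, $x\in\mathbb R^n$. (W$_1$) $W\in C^1(\mathbb R\times\mathbb R^n,\mathbb R)$ and there is $\mu>2$ with $0<\mu W(t,x)\le (x,\nabla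 W(t,x))$ for all $t\in\mathbb R$ and $x\in\mathbb R^n\setminus\{0\}$, where $\nabla$ is the gradient in $x$. (W$_2$) $|\nabla W(t,x)|=o(|x|)$ as $x\to0$, uniformly in $t\in\mathbb R$. Let $X^\alpha=\{u\in H^\alpha(\mathbb R,\mathbb R^n):\int_{\mathbb R}|{}_{-\infty}D_t^{\alpha}u|^2+(L(t)u,u)\,dt<\infty\}$ with the inner product $\langle u,v\rangle=\int_{\mathbb R}({}_{-\infty}D_t^{\alpha}u,{}_{-\infty}D_t^{\alpha}v)+(L(t)u,v)\,dt$. Then $W(\cdot,u(\cdot))$ is integrable for every $u\in X^\alpha$, the functional $$I(u)=\frac12\int_{\mathbb R}\left[|{}_{-\infty}D_t^{\alpha}u|^2+(L(t)u,u)\right]dt-\int_{\mathbb R}W(t,u(t))\,dt$$ is of class $C^1$ on $X^\alpha$, and the fractional Hamiltonian system $${}_tD_\infty^\alpha({}_{-\infty}D_t^\alpha u)+L(t)u=\nabla W(t,u)$$ has a nontrivial weak solution: there is $u\in X^\alpha$, $u\ne0$, such that for all $v\in X^\alpha$ (all integrals being convergent) $$\int_{\mathbb R}\left[({}_{-\infty}D_t^{\alpha}u,{}_{-\infty}D_t^{\alpha}v)+(L(t)u,v)\right]dt=\int_{\mathbb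 R}(\nabla W(t,u),v)\,dt .$$ Moreover $u$ can be taken to be a mountain-pass critical point of $I$: $I'(u)=0$, $I(0)=0$, and there are $\rho,\beta>0$ and $e\in X^\alpha$ with $I\ge\beta$ on $\{\|w\|=\rho\}$, $\|e\|>\rho$, $I(e)\le0$, and $$I(u)=\inf_{\gamma}\max_{s\in[0,1]}I(\gamma(s))\ge\beta,$$ the infimum being over all continuous $\gamma:[0,1]\to X^\alpha$ with $\gamma(0)=0$ and $\gamma(1)=e$. -/

import Mathlib

open MeasureTheory Filter Topology
open scoped ContDiff

noncomputable section

namespace FracHam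

/-- The Euclidean space `ℝⁿ`. -/
abbrev Vec (n : ℕ) : Type := EuclideanSpace ℝ (Fin n)

/-- `L²(ℝ, ℝⁿ)`. -/
abbrev L2 (n : ℕ) : Type := Lp (Vec n) 2 (volume : Measure ℝ)

/-- The product `M x` of a matrix and a vector of `ℝⁿ`. -/
def matVec {n : ℕ} (M : Matrix (Fin n) (Fin n) ℝ) (x : Vec n) : Vec n :=
  WithLp.toLp 2 (M.mulVec x.ofLp)

/-- The left Liouville–Weyl fractional integral of order `β`,
`(1 / Γ(β)) ∫_{-∞}^x (x - ξ)^(β - 1) u(ξ) dξ`. -/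
def leftIntegral {n : ℕ} (β : ℝ) (u : ℝ → Vec n) (x : ℝ) : Vec n :=
  (1 / Real.Gamma β) • ∫ ξ in Set.Iio x, (x - ξ) ^ (β - 1) • u ξ

/-- The left Liouville–Weyl fractional derivative of order `α`, the derivative of the
left fractional integral of order `1 - α`. -/
def leftDeriv {n : ℕ} (α : ℝ) (u : ℝ → Vec n) (x : ℝ) : Vec n :=
  deriv (leftIntegral (1 - α) u) x

/-- The pairs `(φ, D^α φ)` in `L² × L²`, for `φ ∈ C₀^∞(ℝ, ℝⁿ)`. -/
def testGraph (n : ℕ) (α : ℝ) : Set (L2 n × L2 n) :=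
  {p | ∃ φ : ℝ → Vec n, ContDiff ℝ ∞ φ ∧ HasCompactSupport φ ∧
    (p.1 : ℝ → Vec n) =ᵐ[volume] φ ∧ (p.2 : ℝ → Vec n) =ᵐ[volume] leftDeriv α φ}

/-- The space `I^α_{-∞}(ℝ, ℝⁿ) = H^α(ℝ, ℝⁿ)`: the completion of `C₀^∞(ℝ, ℝⁿ)` for the norm
`(‖u‖² + ‖D^α u‖²)^(1/2)` (both norms in `L²`), realized as the closure in `L² × L²` of the graph
of `D^α` on `C₀^∞`. An element is a pair `(u, g)`: the function `u` and its fractional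
derivative `g = D^α u`, the `L²`-limit of `D^α φ_k` along test functions `φ_k → u`.
(`testGraph` is already a linear subspace; `span` only records this.) -/
def fracSobolev (n : ℕ) (α : ℝ) : Submodule ℝ (L2 n × L2 n) :=
  (Submodule.span ℝ (testGraph n α)).topologicalClosure

/-- Condition (L): `L` is continuous with symmetric positive definite values, and
`(L(t)x, x) ≥ l(t)|x|²` for a continuous positive `l` with `l(t) → +∞` as `|t| → ∞`. -/
structure CondL {n : ℕ} (L : ℝ → Matrix (Fin n) (Fin n) ℝ) : Prop where
  continuous : Continuous L
  posDef : ∀ t, (L t).PosDef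
  coercive : ∃ l : ℝ → ℝ, Continuous l ∧ (∀ t, 0 < l t) ∧ Tendsto l (cocompact ℝ) atTop ∧
    ∀ (t : ℝ) (x : Vec n), l t * ‖x‖ ^ 2 ≤ inner ℝ (matVec (L t) x) x

/-- Condition (W₁); the gradient is taken in the second variable. -/
def CondW1 {n : ℕ} (W : ℝ → Vec n → ℝ) : Prop :=
  ContDiff ℝ 1 (fun p : ℝ × Vec n => W p.1 p.2) ∧
  ∃ μ : ℝ, 2 < μ ∧ ∀ (t : ℝ) (x : Vec n), x ≠ 0 →
    0 < μ * W t x ∧ μ * W t x ≤ inner ℝ x (gradient (W t) x)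

/-- Condition (W₂): `|∇W(t,x)| = o(|x|)` as `x → 0`, uniformly in `t`. -/
def CondW2 {n : ℕ} (W : ℝ → Vec n → ℝ) : Prop :=
  ∀ ε : ℝ, 0 < ε → ∃ δ : ℝ, 0 < δ ∧ ∀ (t : ℝ) (x : Vec n), ‖x‖ < δ →
    ‖gradient (W t) x‖ ≤ ε * ‖x‖

section Form

variable {n : ℕ}

theorem inner_matVec (M : Matrix (Fin n) (Fin n) ℝ) (x y : Vec n) :
    inner ℝ (matVec M x) y = ∑ i, ∑ j, M i j * x j * y i := by
  simp only [matVec, PiLp.inner_apply, Matrix.mulVec, dotProduct]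
  refine Finset.sum_congr rfl fun i _ => ?_
  simp [Finset.mul_sum, mul_comm]

theorem matVec_add (M : Matrix (Fin n) (Fin n) ℝ) (x y : Vec n) :
    matVec M (x + y) = matVec M x + matVec M y := by
  simp [matVec, Matrix.mulVec_add]

theorem matVec_smul (M : Matrix (Fin n) (Fin n) ℝ) (c : ℝ) (x : Vec n) :
    matVec M (c • x) = c • matVec M x := by
  simp [matVec, Matrix.mulVec_smul]

theorem inner_matVec_comm {L : ℝ → Matrix (Fin n) (Fin n) ℝ} (hL : CondL L) (t : ℝ)
    (x y : Vec n) : inner ℝ (matVec (L t) x) y = inner ℝ (matVec (L t) y) x := by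
  rw [inner_matVec, inner_matVec, Finset.sum_comm]
  refine Finset.sum_congr rfl fun i _ => Finset.sum_congr rfl fun j _ => ?_
  have h : L t j i = L t i j := by simpa using (hL.posDef t).isHermitian.apply i j
  rw [h]; ring

theorem inner_matVec_nonneg {L : ℝ → Matrix (Fin n) (Fin n) ℝ} (hL : CondL L) (t : ℝ)
    (x : Vec n) : 0 ≤ inner ℝ (matVec (L t) x) x := by
  obtain ⟨l, -, h0, -, h⟩ := hL.coercive
  exact le_trans (mul_nonneg (h0 t).le (sq_nonneg _)) (h t x)

theorem abs_inner_matVec_le {L : ℝ → Matrix (Fin n) (Fin n) ℝ} (hL : CondL L) (t : ℝ)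
    (x y : Vec n) : |inner ℝ (matVec (L t) x) y| ≤
      inner ℝ (matVec (L t) x) x + inner ℝ (matVec (L t) y) y := by
  have hc := inner_matVec_comm hL t x y
  have h1 := inner_matVec_nonneg hL t (x + y)
  have h2 := inner_matVec_nonneg hL t (x + (-1 : ℝ) • y)
  have hx := inner_matVec_nonneg hL t x
  have hy := inner_matVec_nonneg hL t y
  simp only [matVec_add, matVec_smul, inner_add_left, inner_add_right, inner_smul_left,
    inner_smul_right, ← hc] at h1 h2
  simp at h2
  rw [abs_le]
  constructor <;> linarith

theorem aestronglyMeasurable_coord (u : L2 n) (i : Fin n) :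
    AEStronglyMeasurable (fun t => u t i) volume :=
  (EuclideanSpace.proj (𝕜 := ℝ) i : Vec n →L[ℝ] ℝ).continuous.comp_aestronglyMeasurable
    (Lp.aestronglyMeasurable u)

theorem aestronglyMeasurable_form {L : ℝ → Matrix (Fin n) (Fin n) ℝ} (hL : CondL L)
    (u v : L2 n) :
    AEStronglyMeasurable (fun t => inner ℝ (matVec (L t) (u t)) (v t)) volume := by
  simp only [inner_matVec]
  refine Finset.aestronglyMeasurable_fun_sum _ fun i _ =>
    Finset.aestronglyMeasurable_fun_sum _ fun j _ => ?_
  exact ((hL.continuous.matrix_elem i j).aestronglyMeasurable.mul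
    (aestronglyMeasurable_coord u j)).mul (aestronglyMeasurable_coord v i)

theorem integrable_form {L : ℝ → Matrix (Fin n) (Fin n) ℝ} (hL : CondL L) {u v : L2 n}
    (hu : Integrable fun t => inner ℝ (matVec (L t) (u t)) (u t))
    (hv : Integrable fun t => inner ℝ (matVec (L t) (v t)) (v t)) :
    Integrable fun t => inner ℝ (matVec (L t) (u t)) (v t) :=
  (hu.add hv).mono' (aestronglyMeasurable_form hL u v)
    (Eventually.of_forall fun t => abs_inner_matVec_le hL t _ _)

end Form

/-- The space `X^α` of all `u ∈ H^α(ℝ, ℝⁿ)` with `∫ |D^α u|² + (L u, u) dt < ∞`, as a linear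
subspace (`|D^α u|²` is integrable for every `u ∈ H^α`). -/
def xSubmodule {n : ℕ} (α : ℝ) {L : ℝ → Matrix (Fin n) (Fin n) ℝ} (hL : CondL L) :
    Submodule ℝ (L2 n × L2 n) where
  carrier := {p | p ∈ fracSobolev n α ∧
    Integrable fun t => inner ℝ (matVec (L t) (p.1 t)) (p.1 t)}
  zero_mem' := by
    refine ⟨Submodule.zero_mem _, ?_⟩
    refine (integrable_zero ℝ ℝ volume).congr ?_
    filter_upwards [Lp.coeFn_zero (Vec n) 2 (volume : Measure ℝ)] with t ht
    simp only [Prod.fst_zero, ht, Pi.zero_apply, inner_zero_right]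
  add_mem' := by
    rintro p q ⟨hp, hp'⟩ ⟨hq, hq'⟩
    refine ⟨Submodule.add_mem _ hp hq, ?_⟩
    refine (((hp'.add (integrable_form hL hp' hq')).add (integrable_form hL hq' hp')).add
      hq').congr ?_
    filter_upwards [Lp.coeFn_add p.1 q.1] with t ht
    simp only [Prod.fst_add, ht, Pi.add_apply, matVec_add, inner_add_left, inner_add_right]
    ring
  smul_mem' := by
    rintro c p ⟨hp, hp'⟩
    refine ⟨Submodule.smul_mem _ c hp, ?_⟩
    refine (hp'.const_mul (c * c)).congr ?_
    filter_upwards [Lp.coeFn_smul c p.1] with t ht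
    simp only [Prod.smul_fst, ht, Pi.smul_apply, matVec_smul, inner_smul_left, inner_smul_right]
    simp [mul_assoc]

/-- The space `X^α`, which carries its own inner product below (not the one of `L² × L²`). -/
def XSpace {n : ℕ} (α : ℝ) {L : ℝ → Matrix (Fin n) (Fin n) ℝ} (hL : CondL L) : Type :=
  ↥(xSubmodule α hL)

namespace XSpace

variable {n : ℕ} {α : ℝ} {L : ℝ → Matrix (Fin n) (Fin n) ℝ} {hL : CondL L}

instance : AddCommGroup (XSpace α hL) := inferInstanceAs (AddCommGroup ↥(xSubmodule α hL))

instance : Module ℝ (XSpace α hL) := inferInstanceAs (Module ℝ ↥(xSubmodule α hL))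

/-- The function `u ∈ L²` underlying an element of `X^α`. -/
def fn (u : XSpace α hL) : L2 n := u.1.1

/-- The fractional derivative `D^α u ∈ L²` of an element of `X^α`. -/
def D (u : XSpace α hL) : L2 n := u.1.2

theorem fn_add (u v : XSpace α hL) : (u + v).fn = u.fn + v.fn := rfl

theorem D_add (u v : XSpace α hL) : (u + v).D = u.D + v.D := rfl

theorem fn_smul (c : ℝ) (u : XSpace α hL) : (c • u).fn = c • u.fn := rfl

theorem D_smul (c : ℝ) (u : XSpace α hL) : (c • u).D = c • u.D := rfl

theorem ext_pair {u v : XSpace α hL} (h1 : u.fn = v.fn) (h2 : u.D = v.D) : u = v :=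
  Subtype.ext (Prod.ext h1 h2)

/-- The inner product `⟨u, v⟩ = ∫ (D^α u, D^α v) + (L(t) u, v) dt` of `X^α`. -/
def form (u v : XSpace α hL) : ℝ :=
  ∫ t, (inner ℝ (u.D t) (v.D t) + inner ℝ (matVec (L t) (u.fn t)) (v.fn t))

theorem integrable_D (u v : XSpace α hL) : Integrable fun t => inner ℝ (u.D t) (v.D t) :=
  L2.integrable_inner (𝕜 := ℝ) u.D v.D

theorem integrable_L (u v : XSpace α hL) :
    Integrable fun t => inner ℝ (matVec (L t) (u.fn t)) (v.fn t) :=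
  integrable_form hL u.2.2 v.2.2

theorem form_comm (u v : XSpace α hL) : form v u = form u v := by
  refine integral_congr_ae (Eventually.of_forall fun t => ?_)
  simp only [inner_matVec_comm hL t (v.fn t) (u.fn t), real_inner_comm]

theorem form_self_nonneg (u : XSpace α hL) : 0 ≤ form u u :=
  integral_nonneg fun t => add_nonneg real_inner_self_nonneg (inner_matVec_nonneg hL t _)

theorem form_add (u v w : XSpace α hL) : form (u + v) w = form u w + form v w := by
  refine Eq.trans (integral_congr_ae ?_) (integral_add
    ((integrable_D u w).add (integrable_L u w)) ((integrable_D v w).add (integrable_L v w)))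
  filter_upwards [Lp.coeFn_add u.fn v.fn, Lp.coeFn_add u.D v.D] with t h1 h2
  simp only [fn_add, D_add, h1, h2, Pi.add_apply, matVec_add, inner_add_left]
  ring

theorem form_smul (c : ℝ) (u w : XSpace α hL) : form (c • u) w = c * form u w := by
  unfold form
  rw [← integral_const_mul]
  refine integral_congr_ae ?_
  filter_upwards [Lp.coeFn_smul c u.fn, Lp.coeFn_smul c u.D] with t h1 h2
  simp only [fn_smul, D_smul, h1, h2, Pi.smul_apply, matVec_smul, inner_smul_left]
  simp [mul_add]

theorem form_definite (u : XSpace α hL) (h : form u u = 0) : u = 0 := by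
  have hz := (integral_eq_zero_iff_of_nonneg
    (fun t => add_nonneg real_inner_self_nonneg (inner_matVec_nonneg hL t _))
    ((integrable_D u u).add (integrable_L u u))).1 h
  obtain ⟨l, -, h0, -, hl⟩ := hL.coercive
  have key : ∀ᵐ t, u.fn t = 0 ∧ u.D t = 0 := by
    filter_upwards [hz] with t ht
    have ht' : inner ℝ (u.D t) (u.D t) + inner ℝ (matVec (L t) (u.fn t)) (u.fn t) = 0 := ht
    have a : 0 ≤ inner ℝ (u.D t) (u.D t) := real_inner_self_nonneg
    have b := inner_matVec_nonneg hL t (u.fn t)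
    have a0 : inner ℝ (u.D t) (u.D t) = 0 := by linarith
    have b0 : l t * ‖u.fn t‖ ^ 2 ≤ 0 := by linarith [hl t (u.fn t)]
    refine ⟨?_, inner_self_eq_zero.1 a0⟩
    by_contra hne
    have := mul_pos (h0 t) (pow_pos (norm_pos_iff.2 hne) 2)
    linarith
  refine ext_pair ?_ ?_
  · exact (Lp.eq_zero_iff_ae_eq_zero).2 (key.mono fun t ht => ht.1)
  · exact (Lp.eq_zero_iff_ae_eq_zero).2 (key.mono fun t ht => ht.2)

/-- The inner product space structure of `X^α`. -/
@[reducible]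
def core : InnerProductSpace.Core ℝ (XSpace α hL) where
  inner := form
  conj_inner_symm u v := by simpa using form_comm u v
  re_inner_nonneg u := by simpa using form_self_nonneg u
  add_left := form_add
  smul_left u v c := by simpa using form_smul c u v
  definite := form_definite

instance : NormedAddCommGroup (XSpace α hL) :=
  @InnerProductSpace.Core.toNormedAddCommGroup ℝ (XSpace α hL) _ _ _ core

instance : InnerProductSpace ℝ (XSpace α hL) := InnerProductSpace.ofCore core.toCore

end XSpace

/-- The energy functional
`I(u) = ∫ [½ |D^α u|² + ½ (L(t) u, u) - W(t, u)] dt` on `X^α`. -/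
def energy {n : ℕ} {α : ℝ} {L : ℝ → Matrix (Fin n) (Fin n) ℝ} (hL : CondL L)
    (W : ℝ → Vec n → ℝ) (u : XSpace α hL) : ℝ :=
  (1 / 2) * (∫ t, (‖u.D t‖ ^ 2 + inner ℝ (matVec (L t) (u.fn t)) (u.fn t)))
    - ∫ t, W t (u.fn t)

/-- `u ∈ X^α` is a weak solution of the fractional Hamiltonian system:
`∫ [(D^α u, D^α v) + (L(t) u, v)] dt = ∫ (∇W(t, u), v) dt` for all `v ∈ X^α`, where the
integrals converge. -/
def IsWeakSolution {n : ℕ} {α : ℝ} {L : ℝ → Matrix (Fin n) (Fin n) ℝ} {hL : CondL L}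
    (W : ℝ → Vec n → ℝ) (u : XSpace α hL) : Prop :=
  ∀ v : XSpace α hL,
    Integrable (fun t => inner ℝ (u.D t) (v.D t) + inner ℝ (matVec (L t) (u.fn t)) (v.fn t)) ∧
    Integrable (fun t => inner ℝ (gradient (W t) (u.fn t)) (v.fn t)) ∧
    ∫ t, (inner ℝ (u.D t) (v.D t) + inner ℝ (matVec (L t) (u.fn t)) (v.fn t)) =
      ∫ t, inner ℝ (gradient (W t) (u.fn t)) (v.fn t)

/-- `u` is a critical point of `J` at a mountain-pass level: `J'(u) = 0`, `J(0) = 0`, there are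
`ρ, β > 0` and `e` with `J ≥ β` on the sphere of radius `ρ`, `‖e‖ > ρ`, `J(e) ≤ 0`, and
`J(u) = inf_γ max_s J(γ(s)) ≥ β` over the continuous paths `γ` from `0` to `e`. -/
def IsMountainPassPoint {X : Type*} [NormedAddCommGroup X] [NormedSpace ℝ X] (J : X → ℝ)
    (u : X) : Prop :=
  HasFDerivAt J (0 : X →L[ℝ] ℝ) u ∧ J 0 = 0 ∧
  ∃ (ρ β : ℝ) (e : X), 0 < ρ ∧ 0 < β ∧ (∀ w : X, ‖w‖ = ρ → β ≤ J w) ∧ ρ < ‖e‖ ∧ J e ≤ 0 ∧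
    β ≤ J u ∧
    IsGLB {m : ℝ | ∃ γ : C(unitInterval, X), γ 0 = 0 ∧ γ 1 = e ∧
      IsGreatest (Set.range fun s => J (γ s)) m} (J u)

end FracHam

end

/-!
The mountain pass theorem is applied to `I` on the Hilbert space `X^α`, where
`∇I(u) = u - ι* ∇W(·, ι u)` and `ι : X^α → L²` is the embedding. Since `α > 1/2`, the left integral
of order `α` maps `L²` into the `(α - 1/2)`-Hölder functions, so `X^α` embeds in `L^∞`, and since
`l(t) → ∞`, the `L²` mass of a bounded subset of `X^α` is uniformly small near infinity; with the
Hölder bound this makes `ι` compact. By (W₂) the map `u ↦ ∇W(·, ι u)` is linearly bounded on bounded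
subsets of `X^α`, hence continuous for `L²` convergence, and `ι* ∇W(·, ι ·)` is compact. The
superquadraticity (W₁) bounds Palais–Smale sequences, so `I` satisfies the Palais–Smale condition;
(W₂) makes `I` positive on a small sphere and (W₁) makes it negative far out on a ray. The mountain
pass theorem itself follows from Ekeland's variational principle on the space of paths: an almost
minimal path that could be pushed down along `-∇I` near its maxima would contradict it.
-/

noncomputable section

namespace FracHam

section Ekeland

variable {X : Type*} [PseudoMetricSpace X] {f : X → ℝ} {ε : ℝ}

/-- The lower section of `x` for Ekeland's order, in which `y` lies below `x` when
`f y + ε d(y, x) ≤ f x`. -/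
def ekelandSet (f : X → ℝ) (ε : ℝ) (x : X) : Set X :=
  {y | f y + ε * dist y x ≤ f x}

theorem mem_ekelandSet_self (x : X) : x ∈ ekelandSet f ε x := by
  simp [ekelandSet]

theorem ekelandSet_subset (hε : 0 ≤ ε) {x y : X} (hy : y ∈ ekelandSet f ε x) :
    ekelandSet f ε y ⊆ ekelandSet f ε x := by
  intro z hz
  simp only [ekelandSet, Set.mem_ofPred_eq] at *
  have := mul_le_mul_of_nonneg_left (dist_triangle z y x) hε
  linarith

theorem le_of_mem_ekelandSet (hε : 0 ≤ ε) {x y : X} (hy : y ∈ ekelandSet f ε x) : f y ≤ f x :=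
  (le_add_of_nonneg_right (mul_nonneg hε dist_nonneg)).trans hy

theorem isClosed_ekelandSet (hf : LowerSemicontinuous f) (x : X) :
    IsClosed (ekelandSet f ε x) :=
  (hf.add (Continuous.lowerSemicontinuous (by fun_prop))).isClosed_preimage (f x)

theorem exists_minimizing_seq_ekelandSet (hb : BddBelow (Set.range f)) (x₀ : X) :
    ∃ x : ℕ → X, x 0 = x₀ ∧ ∀ k, x (k + 1) ∈ ekelandSet f ε (x k) ∧
      ∀ y ∈ ekelandSet f ε (x k), f (x (k + 1)) ≤ f y + (1 / 2 : ℝ) ^ k := by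
  have near_min (x : X) (k : ℕ) : ∃ z ∈ ekelandSet f ε x,
      ∀ y ∈ ekelandSet f ε x, f z ≤ f y + (1 / 2 : ℝ) ^ k := by
    obtain ⟨_, ⟨z, hz, rfl⟩, hlt⟩ := Real.lt_sInf_add_pos (s := f '' ekelandSet f ε x)
      ⟨_, x, mem_ekelandSet_self x, rfl⟩ (ε := (1 / 2 : ℝ) ^ k) (by positivity)
    refine ⟨z, hz, fun y hy => hlt.le.trans (add_le_add_left ?_ _)⟩
    exact csInf_le (hb.mono (Set.image_subset_range _ _)) ⟨y, hy, rfl⟩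
  choose next hmem hmin using near_min
  exact ⟨fun k => Nat.rec x₀ (fun k y => next y k) k, rfl, fun k => ⟨hmem _ _, hmin _ _⟩⟩

theorem cauchySeq_of_mem_ekelandSet (hb : BddBelow (Set.range f)) (hε : 0 < ε) {x : ℕ → X}
    (hx : ∀ k m, k ≤ m → x m ∈ ekelandSet f ε (x k)) : CauchySeq x := by
  have hanti : Antitone (f ∘ x) := fun k m hkm =>
    le_of_mem_ekelandSet (x := x k) hε.le (hx k m hkm)
  have hbx : BddBelow (Set.range (f ∘ x)) := hb.mono (Set.range_comp_subset_range _ _)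
  rw [Metric.cauchySeq_iff']
  intro δ hδ
  obtain ⟨k, hk⟩ := ((tendsto_order.1 (tendsto_atTop_ciInf hanti hbx)).2 _
    (lt_add_of_pos_right _ (mul_pos hε hδ))).exists
  refine ⟨k, fun m hm => lt_of_mul_lt_mul_left (a := ε) ?_ hε.le⟩
  have hle : f (x m) + ε * dist (x m) (x k) ≤ f (x k) := hx k m hm
  have hinf : (⨅ i, (f ∘ x) i) ≤ f (x m) := ciInf_le hbx m
  simp only [Function.comp] at hk hinf
  linarith

/-- **Ekeland's variational principle** (weak form). -/
theorem exists_ekeland_point [CompleteSpace X] (hf : LowerSemicontinuous f)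
    (hb : BddBelow (Set.range f)) (hε : 0 < ε) (x₀ : X) :
    ∃ x, f x ≤ f x₀ ∧ ∀ y, f x ≤ f y + ε * dist y x := by
  obtain ⟨x, rfl, hx⟩ := exists_minimizing_seq_ekelandSet (ε := ε) hb x₀
  have hmem : ∀ k m, k ≤ m → x m ∈ ekelandSet f ε (x k) := by
    intro k m hkm
    induction m, hkm using Nat.le_induction with
    | base => exact mem_ekelandSet_self _
    | succ m _ ih => exact ekelandSet_subset hε.le ih (hx m).1
  obtain ⟨z, hz⟩ := cauchySeq_tendsto_of_complete (cauchySeq_of_mem_ekelandSet hb hε hmem)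
  have hzmem : ∀ k, z ∈ ekelandSet f ε (x k) := fun k =>
    (isClosed_ekelandSet hf _).mem_of_tendsto hz ((eventually_ge_atTop k).mono (hmem k))
  refine ⟨z, le_of_mem_ekelandSet hε.le (hzmem 0), fun y => ?_⟩
  by_contra! hy
  have hle : f z ≤ f y := by
    have hpow : Tendsto (fun k : ℕ => f y + (1 / 2 : ℝ) ^ k) atTop (𝓝 (f y)) := by
      simpa using (tendsto_pow_atTop_nhds_zero_of_lt_one (r := (1 / 2 : ℝ))
        (by norm_num) (by norm_num)).const_add (f y)
    exact ge_of_tendsto' hpow fun k => (le_of_mem_ekelandSet hε.le (hzmem (k + 1))).trans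
      ((hx k).2 y (ekelandSet_subset hε.le (hzmem k) hy.le))
  exact absurd hy (hle.trans (le_add_of_nonneg_right (mul_nonneg hε.le dist_nonneg))).not_gt

end Ekeland

theorem tendsto_slope_of_hasStrictFDerivAt {X ι : Type*} [NormedAddCommGroup X] [NormedSpace ℝ X]
    {J : X → ℝ} {J' : X →L[ℝ] ℝ} {x w : X} (hJ : HasStrictFDerivAt J J' x) {l : Filter ι}
    {y v : ι → X} {h : ι → ℝ} (hy : Tendsto y l (𝓝 x)) (hv : Tendsto v l (𝓝 w))
    (hh : Tendsto h l (𝓝[≠] 0)) :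
    Tendsto (fun i => (J (y i + h i • v i) - J (y i)) / h i) l (𝓝 (J' w)) := by
  obtain ⟨hh0, hhne⟩ := tendsto_nhdsWithin_iff.1 hh
  have hyv : Tendsto (fun i => y i + h i • v i) l (𝓝 x) := by
    simpa using hy.add (hh0.smul hv)
  have hO : (fun i => h i • v i) =O[l] h := by
    simpa using (Asymptotics.isBigO_refl h l).smul (hv.isBigO_one ℝ)
  have hsmall : (fun i => J (y i + h i • v i) - J (y i) - h i * J' (v i)) =o[l] h := by
    simpa [Function.comp_def] using
      (hJ.isLittleO.comp_tendsto (hyv.prodMk_nhds hy)).trans_isBigO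
        (by simpa [Function.comp_def] using hO)
  refine ((hsmall.tendsto_div_nhds_zero.add ((J'.continuous.tendsto _).comp hv)).congr' ?_).trans
    (by rw [zero_add])
  filter_upwards [hhne] with i hi
  have hi0 : h i ≠ 0 := hi
  simp only [Function.comp]
  field_simp
  ring

section PathMax

variable {K X : Type*} [TopologicalSpace K] [CompactSpace K] [Nonempty K]

/-- The maximum of `J` along a path `γ`, or along a map from any nonempty compact space. -/
def pathMax [TopologicalSpace X] (J : X → ℝ) (γ : C(K, X)) : ℝ :=
  ⨆ s, J (γ s)

theorem isGreatest_pathMax [TopologicalSpace X] {J : X → ℝ} (hJ : Continuous J) (γ : C(K, X)) :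
    IsGreatest (Set.range fun s => J (γ s)) (pathMax J γ) :=
  (isCompact_range (hJ.comp γ.continuous)).isGreatest_sSup (Set.range_nonempty _)

theorem le_pathMax [TopologicalSpace X] {J : X → ℝ} (hJ : Continuous J) (γ : C(K, X)) (s : K) :
    J (γ s) ≤ pathMax J γ :=
  (isGreatest_pathMax hJ γ).2 ⟨s, rfl⟩

theorem lowerSemicontinuous_pathMax [TopologicalSpace X] {J : X → ℝ} (hJ : Continuous J) :
    LowerSemicontinuous (pathMax (K := K) J) :=
  lowerSemicontinuous_ciSup (fun γ => (isGreatest_pathMax hJ γ).bddAbove) fun s =>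
    (hJ.comp (continuous_eval_const s)).lowerSemicontinuous

variable [NormedAddCommGroup X]

/-- Maximizers of `J ∘ (γ + h v)` accumulate, as `h → 0`, at a maximizer of `J ∘ γ`; the strict
derivative there is the limit of the difference quotients. -/
theorem exists_maximizer_neg_le_fderiv [NormedSpace ℝ X] {J : X → ℝ} {J' : X → X →L[ℝ] ℝ}
    (hJ : ∀ x, HasStrictFDerivAt J (J' x) x) {γ v : C(K, X)} {ε : ℝ}
    (hmin : ∀ h > 0, pathMax J γ ≤ pathMax J (γ + h • v) + ε * h) :
    ∃ t, J (γ t) = pathMax J γ ∧ -ε ≤ J' (γ t) (v t) := by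
  have hJc : Continuous J := continuous_iff_continuousAt.2 fun x => (hJ x).continuousAt
  choose s hs using fun h : ℝ => (isGreatest_pathMax hJc (γ + h • v)).1
  let l : Ultrafilter ℝ := Ultrafilter.of (𝓝[>] 0)
  have hl : (l : Filter ℝ) ≤ 𝓝[>] 0 := Ultrafilter.of_le _
  have hpos : ∀ᶠ h : ℝ in l, 0 < h := hl self_mem_nhdsWithin
  have hzero : Tendsto (fun h : ℝ => h) l (𝓝 0) := hl.trans nhdsWithin_le_nhds
  obtain ⟨t, -, ht⟩ := isCompact_univ.ultrafilter_le_nhds (l.map s) (by simp)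
  have hs_lim : Tendsto s l (𝓝 t) := ht
  have hγ : Tendsto (fun h => γ (s h)) l (𝓝 (γ t)) := (γ.continuous.tendsto t).comp hs_lim
  have hv : Tendsto (fun h => v (s h)) l (𝓝 (v t)) := (v.continuous.tendsto t).comp hs_lim
  have hγv : Tendsto (fun h => γ (s h) + h • v (s h)) l (𝓝 (γ t)) := by
    simpa using hγ.add (hzero.smul hv)
  have hge : ∀ᶠ h in l, pathMax J γ - ε * h ≤ J (γ (s h) + h • v (s h)) := by
    filter_upwards [hpos] with h hh
    have := hmin h hh
    simp only [← hs h, ContinuousMap.add_apply, ContinuousMap.smul_apply] at this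
    linarith
  refine ⟨t, le_antisymm (le_pathMax hJc γ t) ?_, ?_⟩
  · refine le_of_tendsto_of_tendsto ?_ ((hJc.tendsto _).comp hγv) hge
    simpa using (hzero.const_mul ε).const_sub (pathMax J γ)
  · have hquot := tendsto_slope_of_hasStrictFDerivAt (hJ (γ t)) hγ hv
      (tendsto_nhdsWithin_iff.2 ⟨hzero, hpos.mono fun h hh => hh.ne'⟩)
    refine ge_of_tendsto hquot ?_
    filter_upwards [hpos, hge] with h hh hle
    rw [le_div_iff₀ hh]
    linarith [le_pathMax hJc γ (s h)]

end PathMax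

section Paths

variable {X : Type*} [TopologicalSpace X] {J : X → ℝ}

/-- The continuous paths from `a` to `b`, as a subset of `C([0, 1], X)`. -/
def pathsBetween (a b : X) : Set C(unitInterval, X) :=
  {γ | γ 0 = a ∧ γ 1 = b}

theorem isClosed_pathsBetween [T2Space X] (a b : X) : IsClosed (pathsBetween a b) :=
  (isClosed_eq (continuous_eval_const _) continuous_const).inter
    (isClosed_eq (continuous_eval_const _) continuous_const)

/-- The minimax level `inf_γ max_s J (γ s)` over the paths from `a` to `b`. -/
def minimaxLevel (J : X → ℝ) (a b : X) : ℝ :=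
  ⨅ γ : pathsBetween a b, pathMax J γ.1

theorem bddBelow_pathMax (hJ : Continuous J) (a b : X) :
    BddBelow (Set.range fun γ : pathsBetween a b => pathMax J γ.1) :=
  ⟨J a, by rintro _ ⟨⟨γ, h0, h1⟩, rfl⟩; exact h0 ▸ le_pathMax hJ γ 0⟩

variable {X : Type*} [NormedAddCommGroup X] {J : X → ℝ}

instance nonempty_pathsBetween [NormedSpace ℝ X] (a b : X) : Nonempty (pathsBetween a b) :=
  ⟨⟨fun s => AffineMap.lineMap a b (s : ℝ), by fun_prop⟩, by simp, by simp⟩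

theorem isGLB_minimaxLevel [NormedSpace ℝ X] (hJ : Continuous J) (a b : X) :
    IsGLB {m : ℝ | ∃ γ : C(unitInterval, X), γ 0 = a ∧ γ 1 = b ∧
      IsGreatest (Set.range fun s => J (γ s)) m} (minimaxLevel J a b) := by
  suffices hset : {m : ℝ | ∃ γ : C(unitInterval, X), γ 0 = a ∧ γ 1 = b ∧
      IsGreatest (Set.range fun s => J (γ s)) m} =
      Set.range fun γ : pathsBetween a b => pathMax J γ.1 by
    rw [hset]
    exact isGLB_ciInf (bddBelow_pathMax hJ a b)
  ext m
  constructor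
  · rintro ⟨γ, h0, h1, hm⟩
    exact ⟨⟨γ, h0, h1⟩, (isGreatest_pathMax hJ γ).unique hm⟩
  · rintro ⟨⟨γ, h0, h1⟩, rfl⟩
    exact ⟨γ, h0, h1, isGreatest_pathMax hJ γ⟩

theorem le_pathMax_of_sphere (hJ : Continuous J) {ρ β : ℝ} {e : X} (hρ : 0 ≤ ρ)
    (hsphere : ∀ w, ‖w‖ = ρ → β ≤ J w) (he : ρ ≤ ‖e‖) {γ : C(unitInterval, X)}
    (hγ : γ ∈ pathsBetween 0 e) : β ≤ pathMax J γ := by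
  obtain ⟨s, hs⟩ := mem_range_of_exists_le_of_exists_ge γ.continuous.norm (c := ρ)
    ⟨0, by simp [hγ.1, hρ]⟩ ⟨1, by simp [hγ.2, he]⟩
  exact (hsphere _ hs).trans (le_pathMax hJ γ s)

end Paths

section MountainPass

variable {X : Type*} [NormedAddCommGroup X] [InnerProductSpace ℝ X]

theorem exists_descent_field {K : Type*} [TopologicalSpace K] (a : C(K, ℝ)) (G : C(K, X))
    {m M ε : ℝ} (hm : m < M) (hε : 0 < ε) :
    ∃ v : C(K, X), (∀ s, ‖v s‖ ≤ 1) ∧ (∀ s, a s ≤ m → v s = 0) ∧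
      ∀ s, M ≤ a s → ε < ‖G s‖ → inner ℝ (G s) (v s) < -ε := by
  let χ : C(K, ℝ) := ⟨fun s => max 0 (min 1 ((a s - m) / (M - m))), by fun_prop⟩
  have hχ0 (s : K) : 0 ≤ χ s := le_max_left _ _
  have hχ1 (s : K) : χ s ≤ 1 := max_le zero_le_one (min_le_left _ _)
  have hden (s : K) : 0 < max ‖G s‖ ε := lt_max_of_lt_right hε
  refine ⟨⟨fun s => -((χ s / max ‖G s‖ ε) • G s), ?_⟩, fun s => ?_, fun s hs => ?_,
    fun s hs hG => ?_⟩
  · exact ((χ.continuous.div (G.continuous.norm.max continuous_const)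
      fun s => (hden s).ne').smul G.continuous).neg
  · rw [ContinuousMap.coe_mk, norm_neg, norm_smul,
      Real.norm_of_nonneg (div_nonneg (hχ0 s) (hden s).le), div_mul_eq_mul_div, div_le_one (hden s)]
    exact (mul_le_of_le_one_left (norm_nonneg _) (hχ1 s)).trans (le_max_left _ _)
  · have hχs : χ s = 0 := max_eq_left (min_le_of_right_le
      (div_nonpos_of_nonpos_of_nonneg (sub_nonpos.2 hs) (sub_pos.2 hm).le))
    simp [hχs]
  · have hχs : χ s = 1 := by
      have : 1 ≤ (a s - m) / (M - m) := (one_le_div (sub_pos.2 hm)).2 (by linarith)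
      simp [χ, this]
    have hG0 : ‖G s‖ ≠ 0 := (hε.trans hG).ne'
    change inner ℝ (G s) (-((χ s / max ‖G s‖ ε) • G s)) < -ε
    rwa [hχs, max_eq_left hG.le, inner_neg_right, inner_smul_right, real_inner_self_eq_norm_sq,
      sq, one_div, inv_mul_cancel_left₀ hG0, neg_lt_neg_iff]

variable [CompleteSpace X] {J : X → ℝ} {g : X → X}

theorem hasStrictFDerivAt_of_hasGradientAt (hJ : ∀ x, HasGradientAt J (g x) x)
    (hg : Continuous g) (x : X) :
    HasStrictFDerivAt J (InnerProductSpace.toDual ℝ X (g x)) x :=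
  hasStrictFDerivAt_of_hasFDerivAt_of_continuousAt
    (Eventually.of_forall fun x => (hJ x).hasFDerivAt)
    ((InnerProductSpace.toDual ℝ X).continuous.comp hg).continuousAt

theorem exists_almost_critical_of_path (hJ : ∀ x, HasGradientAt J (g x) x) (hg : Continuous g)
    {γ : C(unitInterval, X)} (h0 : J (γ 0) < pathMax J γ) (h1 : J (γ 1) < pathMax J γ)
    {ε : ℝ} (hε : 0 < ε)
    (hmin : ∀ η : C(unitInterval, X), η 0 = γ 0 → η 1 = γ 1 →
      pathMax J γ ≤ pathMax J η + ε * dist η γ) :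
    ∃ s, J (γ s) = pathMax J γ ∧ ‖g (γ s)‖ ≤ ε := by
  have hJs := hasStrictFDerivAt_of_hasGradientAt hJ hg
  have hJc : Continuous J := continuous_iff_continuousAt.2 fun x => (hJs x).continuousAt
  obtain ⟨v, hv1, hv0, hdesc⟩ := exists_descent_field (⟨_, hJc.comp γ.continuous⟩)
    ⟨_, hg.comp γ.continuous⟩ (max_lt h0 h1) hε
  have hdist (h : ℝ) (hh : 0 < h) : dist (γ + h • v) γ ≤ h := by
    rw [dist_self_add_left, norm_smul, Real.norm_of_nonneg hh.le]
    exact mul_le_of_le_one_right hh.le ((ContinuousMap.norm_le _ zero_le_one).2 hv1)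
  obtain ⟨t, hmax, ht⟩ := exists_maximizer_neg_le_fderiv (v := v) (ε := ε) hJs fun h hh =>
    (hmin (γ + h • v) (by simp [hv0 0 (le_max_left _ _)])
      (by simp [hv0 1 (le_max_right _ _)])).trans
      (add_le_add_right (mul_le_mul_of_nonneg_left (hdist h hh) hε.le) _)
  refine ⟨t, hmax, not_lt.1 fun hlt => ?_⟩
  exact (hdesc t hmax.ge hlt).not_ge (by simpa using ht)

/-- The **Palais–Smale condition** for a functional `J` with gradient `g`. -/
def PalaisSmale (J : X → ℝ) (g : X → X) : Prop :=
  ∀ (u : ℕ → X) (c : ℝ), Tendsto (fun k => J (u k)) atTop (𝓝 c) →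
    Tendsto (fun k => g (u k)) atTop (𝓝 0) →
    ∃ (x : X) (φ : ℕ → ℕ), StrictMono φ ∧ Tendsto (fun k => u (φ k)) atTop (𝓝 x)

theorem exists_almost_critical_near_minimaxLevel (hJ : ∀ x, HasGradientAt J (g x) x)
    (hg : Continuous g) {a b : X} (hab : ∀ γ ∈ pathsBetween a b, max (J a) (J b) < pathMax J γ)
    {ε : ℝ} (hε : 0 < ε) :
    ∃ x, minimaxLevel J a b ≤ J x ∧ J x ≤ minimaxLevel J a b + ε ∧ ‖g x‖ ≤ ε := by
  have hJc : Continuous J := continuous_iff_continuousAt.2 fun x => (hJ x).continuousAt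
  have hbdd := bddBelow_pathMax hJc a b
  have : CompleteSpace (pathsBetween a b) := (isClosed_pathsBetween a b).completeSpace_coe
  obtain ⟨γ₁, hγ₁⟩ := exists_lt_of_ciInf_lt (lt_add_of_pos_right (minimaxLevel J a b) hε)
  obtain ⟨⟨γ, hγ⟩, hle, hmin⟩ := exists_ekeland_point
    ((lowerSemicontinuous_pathMax hJc).comp continuous_subtype_val) hbdd hε γ₁
  obtain ⟨s, hs, hgs⟩ := exists_almost_critical_of_path hJ hg
    (hγ.1 ▸ (le_max_left _ _).trans_lt (hab γ hγ)) (hγ.2 ▸ (le_max_right _ _).trans_lt (hab γ hγ))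
    hε fun η h0 h1 => hmin ⟨η, h0.trans hγ.1, h1.trans hγ.2⟩
  exact ⟨γ s, hs ▸ ciInf_le hbdd ⟨γ, hγ⟩, hs ▸ (hle.trans_lt hγ₁).le, hgs⟩

theorem exists_critical_point_minimaxLevel (hJ : ∀ x, HasGradientAt J (g x) x)
    (hg : Continuous g) (hPS : PalaisSmale J g) {a b : X}
    (hab : ∀ γ ∈ pathsBetween a b, max (J a) (J b) < pathMax J γ) :
    ∃ u, g u = 0 ∧ J u = minimaxLevel J a b := by
  have hJc : Continuous J := continuous_iff_continuousAt.2 fun x => (hJ x).continuousAt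
  choose u hge hle hgrad using fun k : ℕ =>
    exists_almost_critical_near_minimaxLevel hJ hg hab (ε := 1 / ((k : ℝ) + 1)) (by positivity)
  have hlim : Tendsto (fun k : ℕ => 1 / ((k : ℝ) + 1)) atTop (𝓝 0) :=
    tendsto_one_div_add_atTop_nhds_zero_nat
  have hJu : Tendsto (fun k => J (u k)) atTop (𝓝 (minimaxLevel J a b)) :=
    tendsto_of_tendsto_of_tendsto_of_le_of_le tendsto_const_nhds
      (by simpa using hlim.const_add (minimaxLevel J a b)) hge hle
  have hgu : Tendsto (fun k => g (u k)) atTop (𝓝 0) := squeeze_zero_norm hgrad hlim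
  obtain ⟨x, φ, hφ, hx⟩ := hPS u _ hJu hgu
  exact ⟨x, tendsto_nhds_unique ((hg.tendsto x).comp hx) (hgu.comp hφ.tendsto_atTop),
    tendsto_nhds_unique ((hJc.tendsto x).comp hx) (hJu.comp hφ.tendsto_atTop)⟩

/-- The **mountain pass theorem** of Ambrosetti and Rabinowitz in a Hilbert space. -/
theorem exists_isMountainPassPoint (hJ : ∀ x, HasGradientAt J (g x) x) (hg : Continuous g)
    (hPS : PalaisSmale J g) (hJ0 : J 0 = 0) {ρ β : ℝ} {e : X} (hρ : 0 < ρ) (hβ : 0 < β)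
    (hsphere : ∀ w, ‖w‖ = ρ → β ≤ J w) (he : ρ < ‖e‖) (hJe : J e ≤ 0) :
    ∃ u, g u = 0 ∧ 0 < J u ∧ IsMountainPassPoint J u := by
  have hJc : Continuous J := continuous_iff_continuousAt.2 fun x => (hJ x).continuousAt
  have hle : ∀ γ ∈ pathsBetween 0 e, β ≤ pathMax J γ := fun γ hγ =>
    le_pathMax_of_sphere hJc hρ.le hsphere he.le hγ
  obtain ⟨u, hgu, hJu⟩ := exists_critical_point_minimaxLevel hJ hg hPS (a := 0) (b := e)
    fun γ hγ => (max_le hJ0.le hJe).trans_lt (hβ.trans_le (hle γ hγ))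
  have hβu : β ≤ J u := hJu ▸ le_ciInf fun γ => hle γ.1 γ.2
  refine ⟨u, hgu, hβ.trans_le hβu, ?_, hJ0, ρ, β, e, hρ, hβ, hsphere, he, hJe, hβu, ?_⟩
  · simpa [hgu] using (hJ u).hasFDerivAt
  · exact hJu ▸ isGLB_minimaxLevel hJc 0 e

end MountainPass

section TruncatedPower

open ContinuousLinearMap
open scoped Convolution

/-- The truncated power `x₊^(b - 1)`: up to the factor `Γ(b)`, the kernel of the fractional
integral of order `b`. -/
def truncPow (b : ℝ) : ℝ → ℝ :=
  (Set.Ioi 0).indicator fun x => x ^ (b - 1)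

theorem truncPow_of_pos {b x : ℝ} (hx : 0 < x) : truncPow b x = x ^ (b - 1) :=
  Set.indicator_of_mem (Set.mem_Ioi.2 hx) _

theorem truncPow_of_nonpos {b x : ℝ} (hx : x ≤ 0) : truncPow b x = 0 :=
  Set.indicator_of_notMem (by simpa using hx) _

theorem truncPow_nonneg (b x : ℝ) : 0 ≤ truncPow b x :=
  Set.indicator_nonneg (fun _ hx => Real.rpow_nonneg (le_of_lt hx) _) _

theorem norm_truncPow (b : ℝ) : (fun x => ‖truncPow b x‖) = truncPow b :=
  funext fun x => Real.norm_of_nonneg (truncPow_nonneg b x)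

theorem measurable_truncPow (b : ℝ) : Measurable (truncPow b) :=
  (measurable_id.pow_const _).indicator measurableSet_Ioi

theorem truncPow_mul {b h : ℝ} (hh : 0 < h) (x : ℝ) :
    truncPow b (h * x) = h ^ (b - 1) * truncPow b x := by
  rcases le_or_gt x 0 with hx | hx
  · rw [truncPow_of_nonpos hx, truncPow_of_nonpos (mul_nonpos_of_nonneg_of_nonpos hh.le hx),
      mul_zero]
  · rw [truncPow_of_pos hx, truncPow_of_pos (mul_pos hh hx), Real.mul_rpow hh.le hx.le]

theorem integrableOn_truncPow {b : ℝ} (hb : 0 < b) (R : ℝ) :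
    IntegrableOn (truncPow b) (Set.Iic R) := by
  rw [truncPow, IntegrableOn, integrable_indicator_iff measurableSet_Ioi, IntegrableOn,
    Measure.restrict_restrict measurableSet_Ioi, Set.Ioi_inter_Iic]
  rcases le_total R 0 with h | h
  · simp [Set.Ioc_eq_empty_of_le h]
  · exact (intervalIntegrable_iff_integrableOn_Ioc_of_le h).1
      (intervalIntegral.intervalIntegrable_rpow' (by linarith))

theorem locallyIntegrable_truncPow {b : ℝ} (hb : 0 < b) : LocallyIntegrable (truncPow b) := by
  refine locallyIntegrable_iff.2 fun K hK => ?_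
  obtain ⟨R, hR⟩ := hK.bddAbove
  exact (integrableOn_truncPow hb R).mono_set fun x hx => hR hx

variable {E F : Type*} [NormedAddCommGroup E] [NormedSpace ℝ E] [NormedAddCommGroup F]
  [NormedSpace ℝ F]

theorem convolutionExistsAt_truncPow {b : ℝ} (hb : 0 < b) (B : ℝ →L[ℝ] E →L[ℝ] F) {g : ℝ → E}
    (hg : Continuous g) {a : ℝ} (ha : ∀ x < a, g x = 0) (x : ℝ) :
    ConvolutionExistsAt (truncPow b) g x B := by
  refine HasCompactSupport.convolutionExistsAt B ?_ (locallyIntegrable_truncPow hb) hg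
  refine HasCompactSupport.intro (isCompact_Icc (a := 0) (b := x - a)) fun t ht => ?_
  rcases lt_or_ge t 0 with h | h
  · simp [truncPow_of_nonpos h.le]
  · have : x - a < t := not_le.1 fun h' => ht ⟨h, h'⟩
    simp [ha (x - t) (by linarith)]

theorem convolution_truncPow_eq_zero {b : ℝ} (B : ℝ →L[ℝ] E →L[ℝ] F) {g : ℝ → E} {a : ℝ}
    (ha : ∀ x < a, g x = 0) {x : ℝ} (hx : x < a) : (truncPow b ⋆[B] g) x = 0 := by
  rw [convolution_def]
  refine integral_eq_zero_of_ae (Eventually.of_forall fun t => ?_)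
  rcases le_or_gt t 0 with h | h
  · simp [truncPow_of_nonpos h]
  · simp [ha (x - t) (by linarith)]

theorem indicator_Iic_truncPow_mul {a b R y : ℝ} (hy : y < R) (t : ℝ) :
    (Set.Iic R).indicator (truncPow a) t * (Set.Iic R).indicator (truncPow b) (y - t) =
      truncPow a t * truncPow b (y - t) := by
  rcases le_or_gt t 0 with h | h
  · simp [Set.indicator_apply, truncPow_of_nonpos h]
  rcases le_or_gt (y - t) 0 with h' | h'
  · simp [Set.indicator_apply, truncPow_of_nonpos h']
  rw [Set.indicator_of_mem (Set.mem_Iic.2 (by linarith)),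
    Set.indicator_of_mem (Set.mem_Iic.2 (by linarith))]

theorem ae_convolutionExistsAt_truncPow_truncPow {a b : ℝ} (ha : 0 < a) (hb : 0 < b) :
    ∀ᵐ y : ℝ, ConvolutionExistsAt (truncPow a) (truncPow b) y (mul ℝ ℝ) := by
  have below (N : ℕ) : ∀ᵐ y : ℝ, y < N →
      ConvolutionExistsAt (truncPow a) (truncPow b) y (mul ℝ ℝ) := by
    have hint {c : ℝ} (hc : 0 < c) : Integrable ((Set.Iic (N : ℝ)).indicator (truncPow c)) :=
      (integrable_indicator_iff measurableSet_Iic).2 (integrableOn_truncPow hc N)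
    filter_upwards [(hint ha).ae_convolution_exists (mul ℝ ℝ) (hint hb)] with y hy hyN
    exact Integrable.congr hy (Eventually.of_forall (indicator_Iic_truncPow_mul hyN))
  filter_upwards [ae_all_iff.2 below] with y hy
  obtain ⟨N, hN⟩ := exists_nat_gt y
  exact hy N hN

theorem intervalIntegral_rpow_mul_sub_rpow {a b y : ℝ} (ha : 0 < a) (hb : 0 < b) (hy : 0 < y) :
    ∫ t in (0 : ℝ)..y, t ^ (a - 1) * (y - t) ^ (b - 1) =
      Real.Gamma a * Real.Gamma b / Real.Gamma (a + b) * y ^ (a + b - 1) := by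
  have h := Complex.betaIntegral_scaled (a : ℂ) (b : ℂ) hy
  rw [Complex.betaIntegral_eq_Gamma_mul_div _ _ (by simpa) (by simpa), ← Complex.ofReal_add,
    Complex.Gamma_ofReal, Complex.Gamma_ofReal, Complex.Gamma_ofReal] at h
  apply Complex.ofReal_injective
  rw [← intervalIntegral.integral_ofReal, mul_comm]
  push_cast [Complex.ofReal_cpow hy.le]
  push_cast at h
  rw [← h]
  refine intervalIntegral.integral_congr_ae (Eventually.of_forall fun t ht => ?_)
  rw [Set.uIoc_of_le hy.le] at ht
  push_cast [Complex.ofReal_cpow ht.1.le, Complex.ofReal_cpow (sub_nonneg.2 ht.2)]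
  rfl

theorem convolution_truncPow_truncPow {a b : ℝ} (ha : 0 < a) (hb : 0 < b) :
    truncPow a ⋆[mul ℝ ℝ] truncPow b =
      (Real.Gamma a * Real.Gamma b / Real.Gamma (a + b)) • truncPow (a + b) := by
  ext y
  rw [Pi.smul_apply, smul_eq_mul]
  rcases le_or_gt y 0 with hy | hy
  · rw [truncPow_of_nonpos hy, mul_zero, convolution_mul]
    refine integral_eq_zero_of_ae (Eventually.of_forall fun t => ?_)
    rcases le_or_gt t 0 with h | h
    · simp [truncPow_of_nonpos h]
    · simp [truncPow_of_nonpos (show y - t ≤ 0 by linarith)]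
  rw [truncPow_of_pos hy, ← intervalIntegral_rpow_mul_sub_rpow ha hb hy, convolution_mul,
    intervalIntegral.integral_of_le hy.le, integral_Ioc_eq_integral_Ioo,
    ← integral_indicator measurableSet_Ioo]
  congr 1 with t
  by_cases ht : t ∈ Set.Ioo 0 y
  · rw [Set.indicator_of_mem ht, truncPow_of_pos ht.1, truncPow_of_pos (sub_pos.2 ht.2)]
  rw [Set.indicator_of_notMem ht]
  rcases le_or_gt t 0 with h | h
  · rw [truncPow_of_nonpos h, zero_mul]
  · have : y ≤ t := not_lt.1 fun h' => ht ⟨h, h'⟩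
    rw [truncPow_of_nonpos (sub_nonpos.2 this), mul_zero]

theorem convolution_truncPow_assoc [CompleteSpace E] {a b : ℝ} (ha : 0 < a) (hb : 0 < b)
    {g : ℝ → E} (hg : Continuous g) (hc : HasCompactSupport g) :
    truncPow a ⋆[lsmul ℝ ℝ] (truncPow b ⋆[lsmul ℝ ℝ] g) =
      (Real.Gamma a * Real.Gamma b / Real.Gamma (a + b)) •
        (truncPow (a + b) ⋆[lsmul ℝ ℝ] g) := by
  obtain ⟨m, hm⟩ := hc.isCompact.bddBelow
  have hm' : ∀ x < m, ‖g x‖ = 0 := fun x hx => by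
    rw [image_eq_zero_of_notMem_tsupport fun h => (hm h).not_gt hx, norm_zero]
  rw [← smul_convolution, ← convolution_truncPow_truncPow ha hb]
  ext1 x
  refine (convolution_assoc (mul ℝ ℝ) (lsmul ℝ ℝ) (lsmul ℝ ℝ) (lsmul ℝ ℝ)
    (fun x y z => mul_smul x y z) (measurable_truncPow a).aestronglyMeasurable
    (measurable_truncPow b).aestronglyMeasurable hg.aestronglyMeasurable
    (ae_convolutionExistsAt_truncPow_truncPow ha hb) (Eventually.of_forall fun x => ?_) ?_).symm
  · rw [norm_truncPow]
    exact convolutionExistsAt_truncPow hb (mul ℝ ℝ) hg.norm hm' x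
  · rw [norm_truncPow, norm_truncPow]
    exact convolutionExistsAt_truncPow ha (mul ℝ ℝ)
      (hc.norm.continuous_convolution_right _ (locallyIntegrable_truncPow hb) hg.norm)
      (fun x hx => convolution_truncPow_eq_zero _ hm' hx) x

theorem convolution_truncPow_one_deriv [CompleteSpace E] {φ : ℝ → E} (hφ : ContDiff ℝ 1 φ)
    (hc : HasCompactSupport φ) : truncPow 1 ⋆[lsmul ℝ ℝ] deriv φ = φ := by
  ext1 x
  rw [convolution_lsmul_swap, ← hc.integral_Iic_deriv_eq hφ x, integral_Iic_eq_integral_Iio,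
    ← integral_indicator measurableSet_Iio]
  congr 1 with t
  simp only [truncPow, Set.indicator_apply, Set.mem_Ioi, sub_pos, Set.mem_Iio]
  split_ifs <;> simp

end TruncatedPower

section FractionalIntegral

open ContinuousLinearMap
open scoped Convolution

variable {n : ℕ} {α b : ℝ} {φ ψ : ℝ → Vec n}

theorem leftIntegral_eq_convolution (b : ℝ) (u : ℝ → Vec n) :
    leftIntegral b u = (1 / Real.Gamma b) • (truncPow b ⋆[lsmul ℝ ℝ] u) := by
  ext1 x
  rw [leftIntegral, Pi.smul_apply, convolution_lsmul_swap, ← integral_indicator measurableSet_Iio]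
  congr 2 with t : 1
  by_cases h : t < x
  · rw [Set.indicator_of_mem (Set.mem_Iio.2 h), truncPow_of_pos (sub_pos.2 h)]
  · rw [Set.indicator_of_notMem (by simpa using h), truncPow_of_nonpos (by linarith), zero_smul]

theorem leftIntegral_add (hb : 0 < b) (hφ : Continuous φ) (hφc : HasCompactSupport φ)
    (hψ : Continuous ψ) (hψc : HasCompactSupport ψ) :
    leftIntegral b (φ + ψ) = leftIntegral b φ + leftIntegral b ψ := by
  simp only [leftIntegral_eq_convolution]
  rw [(hφc.convolutionExists_right _ (locallyIntegrable_truncPow hb) hφ).distrib_add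
    (hψc.convolutionExists_right _ (locallyIntegrable_truncPow hb) hψ), smul_add]

theorem leftIntegral_smul (b c : ℝ) (φ : ℝ → Vec n) :
    leftIntegral b (c • φ) = c • leftIntegral b φ := by
  simp only [leftIntegral_eq_convolution]
  rw [convolution_smul, smul_comm]

theorem leftIntegral_leftIntegral {a : ℝ} (ha : 0 < a) (hb : 0 < b) (hφ : Continuous φ)
    (hc : HasCompactSupport φ) :
    leftIntegral a (leftIntegral b φ) = leftIntegral (a + b) φ := by
  have hΓa := (Real.Gamma_pos_of_pos ha).ne'
  have hΓb := (Real.Gamma_pos_of_pos hb).ne'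
  rw [leftIntegral_eq_convolution b, leftIntegral_smul, leftIntegral_eq_convolution a,
    convolution_truncPow_assoc ha hb hφ hc, leftIntegral_eq_convolution, smul_smul, smul_smul]
  congr 1
  field_simp

theorem continuous_leftIntegral (hb : 0 < b) (hφ : Continuous φ) (hc : HasCompactSupport φ) :
    Continuous (leftIntegral b φ) := by
  rw [leftIntegral_eq_convolution]
  exact (hc.continuous_convolution_right _ (locallyIntegrable_truncPow hb) hφ).const_smul _

theorem leftIntegral_one_deriv (hφ : ContDiff ℝ 1 φ) (hc : HasCompactSupport φ) :
    leftIntegral 1 (deriv φ) = φ := by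
  rw [leftIntegral_eq_convolution, convolution_truncPow_one_deriv hφ hc, Real.Gamma_one, div_one,
    one_smul]

theorem hasDerivAt_leftIntegral (hb : 0 < b) (hφ : ContDiff ℝ 1 φ) (hc : HasCompactSupport φ)
    (x : ℝ) : HasDerivAt (leftIntegral b φ) (leftIntegral b (deriv φ) x) x := by
  rw [leftIntegral_eq_convolution, leftIntegral_eq_convolution]
  exact (hc.hasDerivAt_convolution_right (lsmul ℝ ℝ) (locallyIntegrable_truncPow hb)
    hφ x).const_smul _

theorem leftDeriv_eq_leftIntegral_deriv (hα' : α < 1) (hφ : ContDiff ℝ 1 φ)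
    (hc : HasCompactSupport φ) : leftDeriv α φ = leftIntegral (1 - α) (deriv φ) :=
  funext fun x => (hasDerivAt_leftIntegral (sub_pos.2 hα') hφ hc x).deriv

theorem leftDeriv_add (hα' : α < 1) (hφ : ContDiff ℝ 1 φ) (hφc : HasCompactSupport φ)
    (hψ : ContDiff ℝ 1 ψ) (hψc : HasCompactSupport ψ) :
    leftDeriv α (φ + ψ) = leftDeriv α φ + leftDeriv α ψ := by
  have hb := sub_pos.2 hα'
  ext1 x
  rw [leftDeriv, leftIntegral_add hb hφ.continuous hφc hψ.continuous hψc]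
  exact deriv_add (hasDerivAt_leftIntegral hb hφ hφc x).differentiableAt
    (hasDerivAt_leftIntegral hb hψ hψc x).differentiableAt

theorem leftDeriv_smul (α c : ℝ) (φ : ℝ → Vec n) : leftDeriv α (c • φ) = c • leftDeriv α φ := by
  ext1 x
  rw [leftDeriv, leftIntegral_smul]
  exact deriv_const_smul_field c (leftIntegral (1 - α) φ)

theorem leftDeriv_zero (α : ℝ) : leftDeriv α (0 : ℝ → Vec n) = 0 := by
  simpa using leftDeriv_smul α 0 (0 : ℝ → Vec n)

theorem continuous_leftDeriv (hα' : α < 1) (hφ : ContDiff ℝ 1 φ) (hc : HasCompactSupport φ) :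
    Continuous (leftDeriv α φ) := by
  rw [leftDeriv_eq_leftIntegral_deriv hα' hφ hc]
  exact continuous_leftIntegral (sub_pos.2 hα') (hφ.continuous_deriv le_rfl) hc.deriv

theorem leftIntegral_leftDeriv (hα : 0 < α) (hα' : α < 1) (hφ : ContDiff ℝ 1 φ)
    (hc : HasCompactSupport φ) : leftIntegral α (leftDeriv α φ) = φ := by
  rw [leftDeriv_eq_leftIntegral_deriv hα' hφ hc, leftIntegral_leftIntegral hα (sub_pos.2 hα')
    (hφ.continuous_deriv le_rfl) hc.deriv, add_sub_cancel, leftIntegral_one_deriv hφ hc]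

theorem testGraph_add_mem (hα' : α < 1) {p q : L2 n × L2 n} (hp : p ∈ testGraph n α)
    (hq : q ∈ testGraph n α) : p + q ∈ testGraph n α := by
  obtain ⟨φ, hφ, hφc, hp1, hp2⟩ := hp
  obtain ⟨ψ, hψ, hψc, hq1, hq2⟩ := hq
  refine ⟨φ + ψ, hφ.add hψ, hφc.add hψc, (Lp.coeFn_add _ _).trans (hp1.add hq1), ?_⟩
  rw [leftDeriv_add hα' (hφ.of_le (by simp)) hφc (hψ.of_le (by simp)) hψc]
  exact (Lp.coeFn_add _ _).trans (hp2.add hq2)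

theorem testGraph_smul_mem (c : ℝ) {p : L2 n × L2 n} (hp : p ∈ testGraph n α) :
    c • p ∈ testGraph n α := by
  obtain ⟨φ, hφ, hφc, hp1, hp2⟩ := hp
  refine ⟨c • φ, contDiff_const.smul hφ, hφc.smul_left,
    (Lp.coeFn_smul _ _).trans (hp1.const_smul c), ?_⟩
  rw [leftDeriv_smul]
  exact (Lp.coeFn_smul _ _).trans (hp2.const_smul c)

theorem span_testGraph (n : ℕ) (hα' : α < 1) :
    (Submodule.span ℝ (testGraph n α) : Set (L2 n × L2 n)) = testGraph n α := by
  refine Set.Subset.antisymm (fun p hp => ?_) Submodule.subset_span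
  induction hp using Submodule.span_induction with
  | mem _ hp => exact hp
  | zero =>
    refine ⟨0, contDiff_const, HasCompactSupport.zero, Lp.coeFn_zero _ _ _, ?_⟩
    rw [leftDeriv_zero]
    exact Lp.coeFn_zero _ _ _
  | add p q _ _ hp hq => exact testGraph_add_mem hα' hp hq
  | smul c p _ hp => exact testGraph_smul_mem c hp

theorem mem_fracSobolev_iff (hα' : α < 1) {p : L2 n × L2 n} :
    p ∈ fracSobolev n α ↔ p ∈ closure (testGraph n α) := by
  rw [fracSobolev, ← SetLike.mem_coe, Submodule.topologicalClosure_coe, span_testGraph n hα']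

end FractionalIntegral

section SquareIntegrable

variable {Ω : Type*} [MeasurableSpace Ω] {μ : Measure Ω} {E : Type*} [NormedAddCommGroup E]

theorem norm_integral_smul_le_sqrt [NormedSpace ℝ E] {f : Ω → ℝ} {g : Ω → E} (hf : MemLp f 2 μ)
    (hg : MemLp g 2 μ) :
    ‖∫ x, f x • g x ∂μ‖ ≤ √(∫ x, f x ^ 2 ∂μ) * √(∫ x, ‖g x‖ ^ 2 ∂μ) := by
  have h2 : ENNReal.ofReal 2 = 2 := by norm_num
  have hCS := integral_mul_norm_le_Lp_mul_Lq (μ := μ) (f := f) (g := fun x => ‖g x‖)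
    Real.HolderConjugate.two_two (by rwa [h2]) (by rw [h2]; exact hg.norm)
  refine (norm_integral_le_integral_norm _).trans ?_
  simpa only [norm_smul, Real.sqrt_eq_rpow, Real.rpow_ofNat, norm_norm, Real.norm_eq_abs, sq_abs,
    abs_norm] using hCS

theorem norm_setAverage_sq_le [NormedSpace ℝ E] {s : Set Ω} (hs : μ s ≠ ⊤) {g : Ω → E}
    (hg : MemLp g 2 (μ.restrict s)) :
    ‖⨍ x in s, g x ∂μ‖ ^ 2 ≤ (μ.real s)⁻¹ * ∫ x in s, ‖g x‖ ^ 2 ∂μ := by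
  have : IsFiniteMeasure (μ.restrict s) := isFiniteMeasure_restrict.2 hs
  have hCS := norm_integral_smul_le_sqrt (memLp_const (1 : ℝ)) hg
  simp only [one_smul, one_pow, integral_const, smul_eq_mul, mul_one,
    measureReal_restrict_apply_univ] at hCS
  have hsq := pow_le_pow_left₀ (norm_nonneg _) hCS 2
  rw [mul_pow, Real.sq_sqrt measureReal_nonneg,
    Real.sq_sqrt (integral_nonneg fun x => sq_nonneg _)] at hsq
  rcases eq_or_ne (μ.real s) 0 with h0 | h0
  · simp [setAverage_eq, h0]
  · have hpos : 0 < μ.real s := lt_of_le_of_ne measureReal_nonneg h0.symm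
    rw [setAverage_eq, norm_smul, mul_pow, Real.norm_of_nonneg (inv_nonneg.2 hpos.le), sq,
      mul_assoc]
    refine mul_le_mul_of_nonneg_left ?_ (inv_nonneg.2 hpos.le)
    rwa [inv_mul_le_iff₀ hpos]

theorem norm_sq_eq_integral [InnerProductSpace ℝ E] (u : Lp E 2 μ) :
    ‖u‖ ^ 2 = ∫ x, ‖u x‖ ^ 2 ∂μ := by
  rw [← real_inner_self_eq_norm_sq, L2.inner_def]
  simp only [real_inner_self_eq_norm_sq]

theorem integrable_norm_sq (u : Lp E 2 μ) : Integrable (fun x => ‖u x‖ ^ 2) μ :=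
  (memLp_two_iff_integrable_sq_norm (Lp.aestronglyMeasurable u)).1 (Lp.memLp u)

theorem exists_subseq_ae_tendsto {p : ENNReal} [Fact (1 ≤ p)] {u : ℕ → Lp E p μ} {v : Lp E p μ}
    (h : Tendsto u atTop (𝓝 v)) :
    ∃ φ : ℕ → ℕ, StrictMono φ ∧ ∀ᵐ x ∂μ, Tendsto (fun k => u (φ k) x) atTop (𝓝 (v x)) :=
  (tendstoInMeasure_of_tendsto_Lp h).exists_seq_tendsto_ae

end SquareIntegrable

section KernelDifference

theorem truncPow_sq (α x : ℝ) : truncPow α x ^ 2 = truncPow (2 * α - 1) x := by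
  rcases le_or_gt x 0 with hx | hx
  · rw [truncPow_of_nonpos hx, truncPow_of_nonpos hx, zero_pow two_ne_zero]
  · rw [truncPow_of_pos hx, truncPow_of_pos hx, ← Real.rpow_mul_natCast hx.le]
    congr 1
    push_cast
    ring

theorem abs_truncPow_add_one_sub_le {α x : ℝ} (hα : 0 ≤ α) (hα' : α ≤ 1) (hx : 0 < x) :
    |truncPow α (x + 1) - truncPow α x| ≤ x ^ (α - 2) := by
  have hx1 : 0 < x + 1 := by linarith
  have hanti : (x + 1) ^ (α - 1) ≤ x ^ (α - 1) :=
    Real.rpow_le_rpow_of_nonpos hx (by linarith) (by linarith)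
  have hmono : x ^ (α - 1) * x ≤ (x + 1) ^ (α - 1) * (x + 1) := by
    rw [← Real.rpow_add_one hx.ne', ← Real.rpow_add_one hx1.ne', sub_add_cancel]
    exact Real.rpow_le_rpow hx.le (by linarith) hα
  have hpow : x ^ (α - 2) * x = x ^ (α - 1) := by
    rw [← Real.rpow_add_one hx.ne']
    congr 1
    ring
  rw [truncPow_of_pos hx1, truncPow_of_pos hx, abs_sub_comm, abs_of_nonneg (sub_nonneg.2 hanti)]
  refine le_of_mul_le_mul_right ?_ hx
  rw [hpow]
  nlinarith [Real.rpow_nonneg hx1.le (α - 1)]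

theorem integrable_sq_truncPow_add_one_sub {α : ℝ} (hα : 1 / 2 < α) (hα' : α ≤ 1) :
    Integrable fun x => (truncPow α (x + 1) - truncPow α x) ^ 2 := by
  have hm : AEStronglyMeasurable (fun x => (truncPow α (x + 1) - truncPow α x) ^ 2) :=
    ((((measurable_truncPow α).comp (measurable_id.add_const 1)).sub
      (measurable_truncPow α)).pow_const 2).aestronglyMeasurable
  rw [← integrableOn_univ, ← Set.Iic_union_Ioi (a := (1 : ℝ))]
  refine IntegrableOn.union ?_ ?_
  · have hint : ∀ R, IntegrableOn (truncPow (2 * α - 1)) (Set.Iic R) :=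
      integrableOn_truncPow (by linarith)
    have hshift : IntegrableOn (fun x => truncPow (2 * α - 1) (x + 1)) (Set.Iic 1) := by
      have h := (measurePreserving_add_right (volume : Measure ℝ) 1).integrableOn_comp_preimage
        (MeasurableEquiv.addRight (1 : ℝ)).measurableEmbedding (f := truncPow (2 * α - 1))
        (s := Set.Iic (1 + 1))
      rw [Set.preimage_add_const_Iic, add_sub_cancel_right] at h
      exact h.2 (hint _)
    refine (hshift.add (hint 1)).mono' hm.restrict (Eventually.of_forall fun x => ?_)
    rw [Real.norm_of_nonneg (sq_nonneg _), Pi.add_apply, ← truncPow_sq, ← truncPow_sq]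
    nlinarith [mul_nonneg (truncPow_nonneg α (x + 1)) (truncPow_nonneg α x)]
  · refine Integrable.mono' (integrableOn_Ioi_rpow_of_lt
      (by linarith : (α - 2) * 2 < -1) zero_lt_one) hm.restrict ?_
    filter_upwards [ae_restrict_mem measurableSet_Ioi] with x hx
    have hx0 : 0 < x := zero_lt_one.trans hx
    rw [Real.norm_of_nonneg (sq_nonneg _), Real.rpow_mul hx0.le, Real.rpow_two, ← sq_abs]
    exact pow_le_pow_left₀ (abs_nonneg _)
      (abs_truncPow_add_one_sub_le (by linarith) hα' hx0) 2

theorem sq_truncPow_mul_add_sub {α h : ℝ} (hh : 0 < h) (x : ℝ) :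
    (truncPow α (h * x + h) - truncPow α (h * x)) ^ 2 =
      (h ^ (α - 1)) ^ 2 * (truncPow α (x + 1) - truncPow α x) ^ 2 := by
  rw [show h * x + h = h * (x + 1) by ring, truncPow_mul hh, truncPow_mul hh, ← mul_sub, mul_pow]

theorem memLp_truncPow_add_sub {α h : ℝ} (hα : 1 / 2 < α) (hα' : α ≤ 1) (hh : 0 < h) :
    MemLp (fun x => truncPow α (x + h) - truncPow α x) 2 := by
  refine (memLp_two_iff_integrable_sq (((measurable_truncPow α).comp
    (measurable_id.add_const h)).sub (measurable_truncPow α)).aestronglyMeasurable).2 ?_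
  rw [← integrable_comp_mul_left_iff _ hh.ne']
  simp only [Pi.sub_apply, Function.comp, id, sq_truncPow_mul_add_sub hh]
  exact (integrable_sq_truncPow_add_one_sub hα hα').const_mul _

theorem integral_sq_truncPow_add_sub {α h : ℝ} (hh : 0 < h) :
    ∫ x, (truncPow α (x + h) - truncPow α x) ^ 2 =
      (h ^ (α - 1 / 2)) ^ 2 * ∫ x, (truncPow α (x + 1) - truncPow α x) ^ 2 := by
  have hscale := Measure.integral_comp_mul_left
    (fun x => (truncPow α (x + h) - truncPow α x) ^ 2) h
  simp only [sq_truncPow_mul_add_sub hh, integral_const_mul, abs_of_pos (inv_pos.2 hh),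
    smul_eq_mul] at hscale
  rw [eq_comm, inv_mul_eq_iff_eq_mul₀ hh.ne', ← mul_assoc] at hscale
  rw [hscale, ← Real.rpow_mul_natCast hh.le, ← Real.rpow_mul_natCast hh.le, mul_comm h,
    ← Real.rpow_add_one hh.ne']
  congr 2
  push_cast
  ring

/-- The constant of the embedding of `H^α` into `(α - 1/2)`-Hölder continuous functions. -/
def holderConst (α : ℝ) : ℝ :=
  √(∫ x, (truncPow α (x + 1) - truncPow α x) ^ 2) / Real.Gamma α

theorem holderConst_nonneg {α : ℝ} (hα : 0 < α) : 0 ≤ holderConst α :=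
  div_nonneg (Real.sqrt_nonneg _) (Real.Gamma_pos_of_pos hα).le

end KernelDifference

section Holder

open ContinuousLinearMap
open scoped Convolution

variable {n : ℕ} {α : ℝ}

theorem leftIntegral_sub_eq_integral {g : ℝ → Vec n} {x y : ℝ}
    (hx : ConvolutionExistsAt (truncPow α) g x (lsmul ℝ ℝ))
    (hy : ConvolutionExistsAt (truncPow α) g y (lsmul ℝ ℝ)) :
    leftIntegral α g y - leftIntegral α g x =
      (1 / Real.Gamma α) • ∫ s, (truncPow α (y - s) - truncPow α (x - s)) • g s := by
  simp only [leftIntegral_eq_convolution, Pi.smul_apply, convolution_lsmul_swap, sub_smul]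
  rw [← smul_sub]
  congr 1
  exact (integral_sub hy.integrable_swap hx.integrable_swap).symm

theorem norm_leftIntegral_add_sub_le (hα : 1 / 2 < α) (hα' : α ≤ 1) {g : ℝ → Vec n}
    (hg : MemLp g 2) {t h : ℝ} (hh : 0 < h)
    (ht : ConvolutionExistsAt (truncPow α) g t (lsmul ℝ ℝ))
    (hth : ConvolutionExistsAt (truncPow α) g (t + h) (lsmul ℝ ℝ)) :
    ‖leftIntegral α g (t + h) - leftIntegral α g t‖ ≤
      holderConst α * h ^ (α - 1 / 2) * √(∫ s, ‖g s‖ ^ 2) := by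
  have hΓ : 0 ≤ 1 / Real.Gamma α :=
    one_div_nonneg.2 (Real.Gamma_pos_of_pos (by linarith)).le
  have hCS := norm_integral_smul_le_sqrt ((memLp_truncPow_add_sub hα hα' hh).comp_measurePreserving
    (Measure.measurePreserving_sub_left volume t)) hg
  simp only [Function.comp] at hCS
  rw [integral_sub_left_eq_self (fun x => (truncPow α (x + h) - truncPow α x) ^ 2) volume t,
    integral_sq_truncPow_add_sub hh, Real.sqrt_mul (sq_nonneg _),
    Real.sqrt_sq (Real.rpow_nonneg hh.le _)] at hCS
  rw [leftIntegral_sub_eq_integral ht hth, norm_smul, Real.norm_of_nonneg hΓ]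
  simp only [add_sub_right_comm t h]
  refine (mul_le_mul_of_nonneg_left hCS hΓ).trans_eq ?_
  rw [holderConst]
  ring

theorem convolutionExistsAt_leftDeriv (hα : 0 < α) (hα' : α < 1) {φ : ℝ → Vec n}
    (hφ : ContDiff ℝ 1 φ) (hc : HasCompactSupport φ) (x : ℝ) :
    ConvolutionExistsAt (truncPow α) (leftDeriv α φ) x (lsmul ℝ ℝ) := by
  obtain ⟨a, ha⟩ := hc.deriv.isCompact.bddBelow
  have hzero : ∀ x < a, deriv φ x = 0 := fun x hx =>
    image_eq_zero_of_notMem_tsupport fun h => (ha h).not_gt hx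
  refine convolutionExistsAt_truncPow hα _ (continuous_leftDeriv hα' hφ hc) (a := a)
    (fun x hx => ?_) x
  rw [leftDeriv_eq_leftIntegral_deriv hα' hφ hc, leftIntegral_eq_convolution, Pi.smul_apply,
    convolution_truncPow_eq_zero _ hzero hx, smul_zero]

theorem norm_add_sub_le_of_contDiff (hα : 1 / 2 < α) (hα' : α < 1) {φ : ℝ → Vec n}
    (hφ : ContDiff ℝ 1 φ) (hc : HasCompactSupport φ) {g : L2 n} (hg : g =ᵐ[volume] leftDeriv α φ)
    (t : ℝ) {h : ℝ} (hh : 0 < h) :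
    ‖φ (t + h) - φ t‖ ≤ holderConst α * h ^ (α - 1 / 2) * ‖g‖ := by
  have hα0 : 0 < α := by linarith
  have hbound := norm_leftIntegral_add_sub_le hα hα'.le ((memLp_congr_ae hg).1 (Lp.memLp g)) hh
    (convolutionExistsAt_leftDeriv hα0 hα' hφ hc t)
    (convolutionExistsAt_leftDeriv hα0 hα' hφ hc (t + h))
  have hnorm : √(∫ s, ‖leftDeriv α φ s‖ ^ 2) = ‖g‖ := by
    have hsq : ∀ᵐ s, ‖g s‖ ^ 2 = ‖leftDeriv α φ s‖ ^ 2 := hg.mono fun s hs => by rw [hs]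
    rw [← integral_congr_ae hsq, ← norm_sq_eq_integral, Real.sqrt_sq (norm_nonneg _)]
  rwa [leftIntegral_leftDeriv hα0 hα' hφ hc, hnorm] at hbound

end Holder

section Average

variable {E : Type*} [NormedAddCommGroup E]

/-- The average of `u` over `(t, t + r]`: a pointwise substitute for the class `u ∈ L²`, on which
the Hölder regularity of `H^α` is expressed. -/
def average [NormedSpace ℝ E] (r : ℝ) (u : ℝ → E) (t : ℝ) : E :=
  ⨍ s in Set.Ioc t (t + r), u s

theorem memLp_Ioc (u : Lp E 2 (volume : Measure ℝ)) (a b : ℝ) :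
    MemLp u 2 (volume.restrict (Set.Ioc a b)) :=
  (Lp.memLp u).restrict _

theorem volume_real_Ioc_add {r : ℝ} (hr : 0 ≤ r) (t : ℝ) :
    volume.real (Set.Ioc t (t + r)) = r := by
  rw [Real.volume_real_Ioc_of_le (by linarith), add_sub_cancel_left]

theorem average_sub [NormedSpace ℝ E] (r : ℝ) (u v : Lp E 2 (volume : Measure ℝ)) (t : ℝ) :
    average r (u - v : Lp E 2 (volume : Measure ℝ)) t = average r u t - average r v t := by
  have hint : ∀ w : Lp E 2 (volume : Measure ℝ), IntegrableOn w (Set.Ioc t (t + r)) :=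
    fun w => (memLp_Ioc w _ _).integrable one_le_two
  simp only [average, setAverage_eq]
  rw [← smul_sub, ← integral_sub (hint u) (hint v)]
  congr 1
  exact integral_congr_ae (ae_restrict_of_ae (Lp.coeFn_sub u v))

theorem norm_average_sq_le [NormedSpace ℝ E] {r : ℝ} (hr : 0 ≤ r)
    (u : Lp E 2 (volume : Measure ℝ)) (t : ℝ) :
    ‖average r u t‖ ^ 2 ≤ r⁻¹ * ∫ s in Set.Ioc t (t + r), ‖u s‖ ^ 2 := by
  have h := norm_setAverage_sq_le measure_Ioc_lt_top.ne (memLp_Ioc u t (t + r))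
  rwa [volume_real_Ioc_add hr] at h

variable [InnerProductSpace ℝ E]

theorem norm_average_le_norm {r : ℝ} (hr : 0 ≤ r) (u : Lp E 2 (volume : Measure ℝ)) (t : ℝ) :
    ‖average r u t‖ ≤ √r⁻¹ * ‖u‖ := by
  rw [← abs_of_nonneg (norm_nonneg (average r u t)), ← abs_of_nonneg (norm_nonneg u)]
  rw [← Real.sqrt_sq_eq_abs, ← Real.sqrt_sq_eq_abs, ← Real.sqrt_mul (inv_nonneg.2 hr)]
  refine Real.sqrt_le_sqrt ((norm_average_sq_le hr u t).trans ?_)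
  rw [norm_sq_eq_integral]
  exact mul_le_mul_of_nonneg_left (setIntegral_le_integral (integrable_norm_sq u)
    (Eventually.of_forall fun s => sq_nonneg _)) (inv_nonneg.2 hr)

theorem tendsto_average {u : ℕ → Lp E 2 (volume : Measure ℝ)} {v : Lp E 2 (volume : Measure ℝ)}
    (h : Tendsto u atTop (𝓝 v)) {r : ℝ} (hr : 0 ≤ r) (t : ℝ) :
    Tendsto (fun k => average r (u k) t) atTop (𝓝 (average r v t)) := by
  rw [tendsto_iff_norm_sub_tendsto_zero] at h ⊢
  refine squeeze_zero (fun _ => norm_nonneg _) (fun k => ?_)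
    (by simpa only [mul_zero] using h.const_mul (√r⁻¹))
  rw [← average_sub]
  exact norm_average_le_norm hr _ t

end Average

section HolderEmbedding

variable {n : ℕ} {α : ℝ}

theorem ae_norm_sub_average_le_of_mem_testGraph (hα : 1 / 2 < α) (hα' : α < 1)
    {p : L2 n × L2 n} (hp : p ∈ testGraph n α) {r : ℝ} (hr : 0 < r) :
    ∀ᵐ t, ‖p.1 t - average r p.1 t‖ ≤ holderConst α * r ^ (α - 1 / 2) * ‖p.2‖ := by
  obtain ⟨φ, hφ, hc, hp1, hp2⟩ := hp
  filter_upwards [hp1] with t ht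
  have hball : ∀ s ∈ Set.Ioc t (t + r),
      p.1 s = φ s →
        p.1 s ∈ Metric.closedBall (p.1 t) (holderConst α * r ^ (α - 1 / 2) * ‖p.2‖) := by
    intro s hs hps
    have hst := norm_add_sub_le_of_contDiff hα hα' (hφ.of_le (by simp)) hc hp2 t (sub_pos.2 hs.1)
    rw [add_sub_cancel] at hst
    rw [mem_closedBall_iff_norm, hps, ht]
    refine hst.trans (mul_le_mul_of_nonneg_right (mul_le_mul_of_nonneg_left ?_
      (holderConst_nonneg (by linarith))) (norm_nonneg _))
    exact Real.rpow_le_rpow (sub_pos.2 hs.1).le (by linarith [hs.2]) (by linarith)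
  have hmem := (convex_closedBall (p.1 t) _).set_average_mem Metric.isClosed_closedBall
    (by simpa using hr) measure_Ioc_lt_top.ne
    (by filter_upwards [ae_restrict_mem measurableSet_Ioc, ae_restrict_of_ae hp1] using hball)
    ((memLp_Ioc p.1 t (t + r)).integrable one_le_two)
  rwa [mem_closedBall_iff_norm, norm_sub_rev] at hmem

theorem ae_norm_sub_average_le (hα : 1 / 2 < α) (hα' : α < 1) {p : L2 n × L2 n}
    (hp : p ∈ fracSobolev n α) {r : ℝ} (hr : 0 < r) :
    ∀ᵐ t, ‖p.1 t - average r p.1 t‖ ≤ holderConst α * r ^ (α - 1 / 2) * ‖p.2‖ := by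
  obtain ⟨q, hq, hlim⟩ := mem_closure_iff_seq_limit.1 ((mem_fracSobolev_iff hα').1 hp)
  have hlim1 : Tendsto (fun k => (q k).1) atTop (𝓝 p.1) := (continuous_fst.tendsto p).comp hlim
  have hlim2 : Tendsto (fun k => (q k).2) atTop (𝓝 p.2) := (continuous_snd.tendsto p).comp hlim
  obtain ⟨φ, hφ, hae⟩ := exists_subseq_ae_tendsto hlim1
  filter_upwards [hae, ae_all_iff.2 fun k =>
    ae_norm_sub_average_le_of_mem_testGraph hα hα' (hq k) hr] with t ht hk
  exact le_of_tendsto_of_tendsto'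
    ((ht.sub ((tendsto_average hlim1 hr.le t).comp hφ.tendsto_atTop)).norm)
    ((hlim2.comp hφ.tendsto_atTop).norm.const_mul _) fun k => hk (φ k)

end HolderEmbedding

section TestFunctions

open ContinuousLinearMap
open scoped Convolution

theorem norm_convolution_truncPow_le {E : Type*} [NormedAddCommGroup E] [NormedSpace ℝ E]
    {b : ℝ} (hb : b ≤ 1) {g : ℝ → E} (hg : Integrable g) {R : ℝ}
    (hR : ∀ x, R < x → g x = 0) {t : ℝ} (ht : R < t) :
    ‖(truncPow b ⋆[lsmul ℝ ℝ] g) t‖ ≤ (∫ s, ‖g s‖) * (t - R) ^ (b - 1) := by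
  rw [convolution_lsmul_swap, ← integral_mul_const]
  refine norm_integral_le_of_norm_le (hg.norm.mul_const _) (Eventually.of_forall fun s => ?_)
  rcases lt_or_ge R s with h | h
  · simp [hR s h]
  · rw [norm_smul, mul_comm, Real.norm_of_nonneg (truncPow_nonneg _ _),
      truncPow_of_pos (by linarith : 0 < t - s)]
    exact mul_le_mul_of_nonneg_left (Real.rpow_le_rpow_of_nonpos (sub_pos.2 ht) (by linarith)
      (by linarith)) (norm_nonneg _)

theorem integrableOn_Ioi_sub_rpow {c R : ℝ} (hc : c < -1) :
    IntegrableOn (fun t : ℝ => (t - R) ^ c) (Set.Ioi (R + 1)) := by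
  have h := (measurePreserving_sub_right (volume : Measure ℝ) R).integrableOn_comp_preimage
    (MeasurableEquiv.subRight R).measurableEmbedding (f := fun t : ℝ => t ^ c) (s := Set.Ioi 1)
  rw [Set.preimage_sub_const_Ioi, add_comm] at h
  exact h.2 (integrableOn_Ioi_rpow_of_lt hc zero_lt_one)

theorem memLp_convolution_truncPow {E : Type*} [NormedAddCommGroup E] [NormedSpace ℝ E] {b : ℝ}
    (hb : 0 < b) (hb' : b < 1 / 2) {g : ℝ → E} (hg : Continuous g) (hc : HasCompactSupport g) :
    MemLp (truncPow b ⋆[lsmul ℝ ℝ] g) 2 := by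
  obtain ⟨a, ha⟩ := hc.isCompact.bddBelow
  obtain ⟨R, hR⟩ := hc.isCompact.bddAbove
  have hzero : ∀ x < a, g x = 0 := fun x hx =>
    image_eq_zero_of_notMem_tsupport fun h => (ha h).not_gt hx
  have hzero' : ∀ x, R < x → g x = 0 := fun x hx =>
    image_eq_zero_of_notMem_tsupport fun h => (hR h).not_gt hx
  have hcont : Continuous (truncPow b ⋆[lsmul ℝ ℝ] g) :=
    hc.continuous_convolution_right _ (locallyIntegrable_truncPow hb) hg
  refine (memLp_two_iff_integrable_sq_norm hcont.aestronglyMeasurable).2 ?_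
  have hcover : Set.Iio a ∪ (Set.Icc a (R + 1) ∪ Set.Ioi (R + 1)) = Set.univ := by
    refine Set.eq_univ_of_forall fun x => ?_
    rcases lt_or_ge x a with h | h
    · exact Or.inl h
    · exact Or.inr ((le_or_gt x (R + 1)).imp (fun h' => ⟨h, h'⟩) id)
  rw [← integrableOn_univ, ← hcover]
  refine IntegrableOn.union ?_ (IntegrableOn.union ?_ ?_)
  · refine IntegrableOn.congr_fun integrableOn_zero (fun x hx => ?_) measurableSet_Iio
    simp [convolution_truncPow_eq_zero (lsmul ℝ ℝ) hzero hx]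
  · exact (hcont.norm.pow 2).continuousOn.integrableOn_Icc
  · refine Integrable.mono' ((integrableOn_Ioi_sub_rpow
      (by push_cast; linarith : (b - 1) * (2 : ℕ) < -1)).const_mul ((∫ s, ‖g s‖) ^ 2))
      (hcont.norm.pow 2).aestronglyMeasurable ?_
    filter_upwards [ae_restrict_mem measurableSet_Ioi] with t ht
    have hRt : R < t := (lt_add_one R).trans ht
    rw [norm_pow, norm_norm, Real.rpow_mul_natCast (sub_nonneg.2 hRt.le), ← mul_pow]
    exact pow_le_pow_left₀ (norm_nonneg _) (norm_convolution_truncPow_le (by linarith)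
      (hg.integrable_of_hasCompactSupport hc) hzero' hRt) 2

variable {n : ℕ} {α : ℝ}

theorem memLp_leftDeriv (hα : 1 / 2 < α) (hα' : α < 1) {φ : ℝ → Vec n} (hφ : ContDiff ℝ 1 φ)
    (hc : HasCompactSupport φ) : MemLp (leftDeriv α φ) 2 := by
  rw [leftDeriv_eq_leftIntegral_deriv hα' hφ hc, leftIntegral_eq_convolution]
  exact (memLp_convolution_truncPow (sub_pos.2 hα') (by linarith) (hφ.continuous_deriv le_rfl)
    hc.deriv).const_smul _

theorem exists_mem_testGraph_fst_ne_zero (hn : 1 ≤ n) (hα : 1 / 2 < α) (hα' : α < 1) :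
    ∃ p ∈ testGraph n α, p.1 ≠ 0 := by
  let f : ContDiffBump (0 : ℝ) := ⟨1, 2, one_pos, one_lt_two⟩
  let x₀ : Vec n := EuclideanSpace.single ⟨0, hn⟩ 1
  have hx₀ : x₀ ≠ 0 := by simp [x₀]
  let φ : ℝ → Vec n := fun t => f t • x₀
  have hφ : ContDiff ℝ ∞ φ := f.contDiff.smul contDiff_const
  have hc : HasCompactSupport φ := f.hasCompactSupport.smul_right
  have h1 : MemLp φ 2 := hφ.continuous.memLp_of_hasCompactSupport hc
  have h2 : MemLp (leftDeriv α φ) 2 := memLp_leftDeriv hα hα' (hφ.of_le (by simp)) hc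
  refine ⟨(h1.toLp φ, h2.toLp _), ⟨φ, hφ, hc, h1.coeFn_toLp, h2.coeFn_toLp⟩, fun h0 => ?_⟩
  have hae : φ =ᵐ[volume] fun _ => 0 :=
    h1.coeFn_toLp.symm.trans (Lp.eq_zero_iff_ae_eq_zero.1 h0)
  have hφ0 : f 0 • x₀ = 0 :=
    congr_fun ((hφ.continuous.ae_eq_iff_eq volume continuous_const).1 hae) 0
  rw [f.one_of_mem_closedBall (Metric.mem_closedBall_self zero_le_one), one_smul] at hφ0
  exact hx₀ hφ0

end TestFunctions

section Limits

variable {Ω : Type*} [MeasurableSpace Ω] {μ : Measure Ω}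

theorem integral_le_of_ae_tendsto {f : ℕ → Ω → ℝ} {g : Ω → ℝ} {c : ℝ}
    (hf : ∀ k, Integrable (f k) μ) (hf0 : ∀ k, 0 ≤ᵐ[μ] f k) (hle : ∀ k, ∫ x, f k x ∂μ ≤ c)
    (hlim : ∀ᵐ x ∂μ, Tendsto (fun k => f k x) atTop (𝓝 (g x))) :
    Integrable g μ ∧ ∫ x, g x ∂μ ≤ c := by
  have hg0 : 0 ≤ᵐ[μ] g := by
    filter_upwards [hlim, ae_all_iff.2 hf0] with x hx h0 using ge_of_tendsto' hx h0
  have hFatou : ∫⁻ x, ENNReal.ofReal (g x) ∂μ ≤ ENNReal.ofReal c := by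
    calc ∫⁻ x, ENNReal.ofReal (g x) ∂μ
        = ∫⁻ x, liminf (fun k => ENNReal.ofReal (f k x)) atTop ∂μ := by
          refine lintegral_congr_ae ?_
          filter_upwards [hlim] with x hx using (ENNReal.tendsto_ofReal hx).liminf_eq.symm
      _ ≤ liminf (fun k => ∫⁻ x, ENNReal.ofReal (f k x) ∂μ) atTop :=
          lintegral_liminf_le' fun k => (hf k).1.aemeasurable.ennreal_ofReal
      _ ≤ ENNReal.ofReal c := by
          refine liminf_le_of_frequently_le' (Eventually.frequently (.of_forall fun k => ?_))
          rw [← ofReal_integral_eq_lintegral_ofReal (hf k) (hf0 k)]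
          exact ENNReal.ofReal_le_ofReal (hle k)
  have hg : Integrable g μ := by
    refine ⟨aestronglyMeasurable_of_tendsto_ae _ (fun k => (hf k).1) hlim, ?_⟩
    rw [hasFiniteIntegral_iff_ofReal hg0]
    exact hFatou.trans_lt ENNReal.ofReal_lt_top
  refine ⟨hg, ?_⟩
  rw [← ofReal_integral_eq_lintegral_ofReal hg hg0] at hFatou
  exact (ENNReal.ofReal_le_ofReal_iff ((integral_nonneg_of_ae (hf0 0)).trans (hle 0))).1 hFatou

theorem cauchySeq_of_forall_dist_le {X : Type*} [PseudoMetricSpace X] {x : ℕ → X}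
    (h : ∀ ε > 0, ∃ y : ℕ → X, CauchySeq y ∧ ∀ k, dist (x k) (y k) ≤ ε) : CauchySeq x := by
  refine Metric.cauchySeq_iff'.2 fun ε hε => ?_
  obtain ⟨y, hy, hxy⟩ := h (ε / 3) (by positivity)
  obtain ⟨N, hN⟩ := Metric.cauchySeq_iff'.1 hy (ε / 3) (by positivity)
  refine ⟨N, fun k hk => ?_⟩
  have h1 := dist_triangle4 (x k) (y k) (y N) (x N)
  have h2 := hxy N
  rw [dist_comm] at h2
  linarith [hxy k, hN k hk]

theorem exists_subseq_tendsto_inner {H : Type*} [NormedAddCommGroup H] [InnerProductSpace ℝ H]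
    [CompleteSpace H] [TopologicalSpace.SeparableSpace H] {u : ℕ → H} {M : ℝ}
    (hu : ∀ k, ‖u k‖ ≤ M) :
    ∃ φ : ℕ → ℕ, StrictMono φ ∧
      ∀ w, ∃ l, Tendsto (fun k => inner ℝ w (u (φ k))) atTop (𝓝 l) := by
  have hmem : ∀ k, StrongDual.toWeakDual (InnerProductSpace.toDual ℝ H (u k)) ∈
      (WeakDual.toStrongDual ⁻¹' Metric.closedBall (0 : StrongDual ℝ H) M) :=
    fun k => by simpa using hu k
  obtain ⟨a, -, φ, hφ, ha⟩ := WeakDual.isSeqCompact_closedBall ℝ H 0 M hmem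
  refine ⟨φ, hφ, fun w => ⟨a w, ?_⟩⟩
  exact (((WeakDual.eval_continuous w).tendsto a).comp ha).congr
    fun k => real_inner_comm w (u (φ k))

theorem unifIntegrable_of_ae_norm_le {ι E : Type*} [NormedAddCommGroup E] {p : ENNReal}
    (hp : 1 ≤ p) (hp' : p ≠ ⊤) {f : ι → Ω → E} (hf : ∀ i, AEStronglyMeasurable (f i) μ) {C : ℝ}
    (hC : ∀ i, ∀ᵐ x ∂μ, ‖f i x‖ ≤ C) : UnifIntegrable f p μ := by
  refine unifIntegrable_of hp hp' hf fun ε _ => ⟨C.toNNReal + 1, fun i => ?_⟩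
  have hzero : {x | C.toNNReal + 1 ≤ ‖f i x‖₊}.indicator (f i) =ᵐ[μ] 0 := by
    filter_upwards [hC i] with x hx
    refine Set.indicator_of_notMem (fun hmem => ?_) _
    have hle : (C.toNNReal : ℝ) + 1 ≤ ‖f i x‖ := by exact_mod_cast hmem
    linarith [Real.le_coe_toNNReal C]
  simp [eLpNorm_congr_ae hzero]

theorem eLpNorm_two_indicator_le {E : Type*} [NormedAddCommGroup E] {f : Ω → E}
    (hf : MemLp f 2 μ) {s : Set Ω} (hs : MeasurableSet s) {ε : ℝ}
    (hle : ∫ x in s, ‖f x‖ ^ 2 ∂μ ≤ ε ^ 2) (hε : 0 ≤ ε) :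
    eLpNorm (s.indicator f) 2 μ ≤ ENNReal.ofReal ε := by
  rw [eLpNorm_indicator_eq_eLpNorm_restrict hs,
    (hf.restrict s).eLpNorm_eq_integral_rpow_norm two_ne_zero ENNReal.ofNat_ne_top]
  refine ENNReal.ofReal_le_ofReal ?_
  simp only [ENNReal.toReal_ofNat, Real.rpow_ofNat]
  rw [← one_div, ← Real.sqrt_eq_rpow]
  exact Real.sqrt_le_iff.2 ⟨hε, hle⟩

variable {E : Type*} [NormedAddCommGroup E] {p : ENNReal} [Fact (1 ≤ p)]

theorem exists_Lp_ae_tendsto {u : ℕ → Lp E p μ} {M : ℝ} (hM : ∀ k, ‖u k‖ ≤ M)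
    (hlim : ∀ᵐ x ∂μ, ∃ l, Tendsto (fun k => u k x) atTop (𝓝 l)) :
    ∃ w : Lp E p μ, ∀ᵐ x ∂μ, Tendsto (fun k => u k x) atTop (𝓝 (w x)) := by
  obtain ⟨w, hw, hlimw⟩ := exists_stronglyMeasurable_limit_of_tendsto_ae
    (fun k => Lp.aestronglyMeasurable (u k)) hlim
  have hnorm : ∀ k, eLpNorm (u k) p μ ≤ ENNReal.ofReal M := fun k => by
    rw [← Lp.enorm_def, ← ofReal_norm]
    exact ENNReal.ofReal_le_ofReal (hM k)
  have hwL : MemLp w p μ := ⟨hw.aestronglyMeasurable,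
    calc eLpNorm w p μ ≤ liminf (fun k => eLpNorm (u k) p μ) atTop :=
          Lp.eLpNorm_lim_le_liminf_eLpNorm (fun k => Lp.aestronglyMeasurable (u k)) w hlimw
      _ ≤ ENNReal.ofReal M :=
          liminf_le_of_frequently_le' (Eventually.frequently (.of_forall hnorm))
      _ < ⊤ := ENNReal.ofReal_lt_top⟩
  refine ⟨hwL.toLp w, ?_⟩
  filter_upwards [hlimw, hwL.coeFn_toLp] with x hx hwx using by rwa [hwx]

theorem Lp_tendsto_of_ae_tendsto (hp : p ≠ ⊤) {u : ℕ → Lp E p μ} {w : Lp E p μ}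
    (hui : UnifIntegrable (fun k => u k) p μ) (hut : UnifTight (fun k => u k) p μ)
    (hlim : ∀ᵐ x ∂μ, Tendsto (fun k => u k x) atTop (𝓝 (w x))) : Tendsto u atTop (𝓝 w) :=
  (Lp.tendsto_Lp_iff_tendsto_eLpNorm' u w).2 (tendsto_Lp_of_tendsto_ae Fact.out hp
    (fun k => Lp.aestronglyMeasurable (u k)) (Lp.memLp w) hui hut hlim)

end Limits

section Coercivity

variable {n : ℕ} {L : ℝ → Matrix (Fin n) (Fin n) ℝ}

theorem CondL.exists_lower_bound (hL : CondL L) :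
    ∃ m > 0, ∀ (t : ℝ) (x : Vec n), m * ‖x‖ ^ 2 ≤ inner ℝ (matVec (L t) x) x := by
  obtain ⟨l, hc, h0, hlim, h⟩ := hL.coercive
  obtain ⟨t₀, ht₀⟩ := hc.exists_forall_le hlim
  exact ⟨l t₀, h0 t₀, fun t x =>
    (mul_le_mul_of_nonneg_right (ht₀ t) (sq_nonneg _)).trans (h t x)⟩

theorem CondL.exists_lower_bound_at_infinity (hL : CondL L) (A : ℝ) :
    ∃ T : ℝ, ∀ t, T ≤ |t| → ∀ x : Vec n, A * ‖x‖ ^ 2 ≤ inner ℝ (matVec (L t) x) x := by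
  obtain ⟨l, -, -, hlim, h⟩ := hL.coercive
  have hA := hlim.eventually (eventually_ge_atTop A)
  rw [← Metric.cobounded_eq_cocompact, ← comap_norm_atTop, eventually_comap] at hA
  obtain ⟨T, hT⟩ := eventually_atTop.1 hA
  exact ⟨T, fun t ht x =>
    (mul_le_mul_of_nonneg_right (hT _ ht t rfl) (sq_nonneg _)).trans (h t x)⟩

theorem continuous_inner_matVec_self (A : Matrix (Fin n) (Fin n) ℝ) :
    Continuous fun x : Vec n => inner ℝ (matVec A x) x := by
  simp only [inner_matVec]
  fun_prop

end Coercivity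

namespace XSpace

variable {n : ℕ} {α : ℝ} {L : ℝ → Matrix (Fin n) (Fin n) ℝ} {hL : CondL L}

theorem inner_eq_form (u v : XSpace α hL) : inner ℝ u v = form u v := rfl

theorem norm_sq_eq_integral (u : XSpace α hL) :
    ‖u‖ ^ 2 = ∫ t, (‖u.D t‖ ^ 2 + inner ℝ (matVec (L t) (u.fn t)) (u.fn t)) := by
  rw [← real_inner_self_eq_norm_sq, inner_eq_form, form]
  simp only [real_inner_self_eq_norm_sq]

theorem norm_sq_eq_add (u : XSpace α hL) :
    ‖u‖ ^ 2 = ‖u.D‖ ^ 2 + ∫ t, inner ℝ (matVec (L t) (u.fn t)) (u.fn t) := by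
  rw [norm_sq_eq_integral, integral_add (integrable_norm_sq u.D) (integrable_L u u),
    FracHam.norm_sq_eq_integral]

theorem integral_form_le (u : XSpace α hL) :
    ∫ t, inner ℝ (matVec (L t) (u.fn t)) (u.fn t) ≤ ‖u‖ ^ 2 := by
  rw [norm_sq_eq_add]
  linarith [sq_nonneg ‖u.D‖]

theorem norm_D_le (u : XSpace α hL) : ‖u.D‖ ≤ ‖u‖ := by
  refine (sq_le_sq₀ (norm_nonneg _) (norm_nonneg _)).1 ?_
  rw [norm_sq_eq_add]
  exact le_add_of_nonneg_right (integral_nonneg fun t => inner_matVec_nonneg hL t _)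

theorem mul_setIntegral_norm_sq_le {A : ℝ} {S : Set ℝ} (hS : MeasurableSet S)
    (hA : ∀ t ∈ S, ∀ x : Vec n, A * ‖x‖ ^ 2 ≤ inner ℝ (matVec (L t) x) x) (u : XSpace α hL) :
    A * ∫ t in S, ‖u.fn t‖ ^ 2 ≤ ‖u‖ ^ 2 := by
  calc A * ∫ t in S, ‖u.fn t‖ ^ 2
      = ∫ t in S, A * ‖u.fn t‖ ^ 2 := (integral_const_mul _ _).symm
    _ ≤ ∫ t in S, inner ℝ (matVec (L t) (u.fn t)) (u.fn t) :=
        setIntegral_mono_on ((integrable_norm_sq _).const_mul _).integrableOn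
          (integrable_L u u).integrableOn hS fun t ht => hA t ht _
    _ ≤ ∫ t, inner ℝ (matVec (L t) (u.fn t)) (u.fn t) :=
        setIntegral_le_integral (integrable_L u u)
          (Eventually.of_forall fun t => inner_matVec_nonneg hL t _)
    _ ≤ ‖u‖ ^ 2 := integral_form_le u

variable (α hL) in
theorem exists_norm_fn_le : ∃ C > 0, ∀ u : XSpace α hL, ‖u.fn‖ ≤ C * ‖u‖ := by
  obtain ⟨m, hm, hmL⟩ := hL.exists_lower_bound
  refine ⟨(√m)⁻¹, by positivity, fun u => ?_⟩
  have hu := mul_setIntegral_norm_sq_le MeasurableSet.univ (fun t _ => hmL t) u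
  rw [setIntegral_univ, ← FracHam.norm_sq_eq_integral] at hu
  rw [inv_mul_eq_div, le_div_iff₀ (Real.sqrt_pos.2 hm)]
  refine (sq_le_sq₀ (by positivity) (norm_nonneg _)).1 ?_
  rwa [mul_pow, Real.sq_sqrt hm.le, mul_comm]

/-- The embedding of `X^α` into `L²`. -/
def fnL : XSpace α hL →L[ℝ] L2 n :=
  LinearMap.mkContinuousOfExistsBound
    { toFun := fn, map_add' := fn_add, map_smul' := fn_smul }
    (let ⟨C, _, hC⟩ := exists_norm_fn_le α hL; ⟨C, hC⟩)

theorem fnL_apply (u : XSpace α hL) : fnL u = u.fn := rfl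

/-- The fractional derivative, as a bounded operator from `X^α` to `L²`. -/
def DL : XSpace α hL →L[ℝ] L2 n :=
  LinearMap.mkContinuous { toFun := D, map_add' := D_add, map_smul' := D_smul } 1
    fun u => (norm_D_le u).trans_eq (one_mul _).symm

theorem exists_norm_le_of_tendsto {u : ℕ → XSpace α hL} {c : ℝ} (hc : ∀ k, ‖u k‖ ≤ c)
    {f g : L2 n} (hf : Tendsto (fun k => (u k).fn) atTop (𝓝 f))
    (hg : Tendsto (fun k => (u k).D) atTop (𝓝 g)) :
    ∃ x : XSpace α hL, x.fn = f ∧ x.D = g ∧ ‖x‖ ≤ c := by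
  obtain ⟨φ, hφ, haef⟩ := exists_subseq_ae_tendsto hf
  obtain ⟨ψ, hψ, haeg⟩ := exists_subseq_ae_tendsto (hg.comp hφ.tendsto_atTop)
  have hc0 : 0 ≤ c := (norm_nonneg _).trans (hc 0)
  obtain ⟨hint, hle⟩ := integral_le_of_ae_tendsto
    (f := fun k t => ‖(u (φ (ψ k))).D t‖ ^ 2 +
      inner ℝ (matVec (L t) ((u (φ (ψ k))).fn t)) ((u (φ (ψ k))).fn t))
    (g := fun t => ‖g t‖ ^ 2 + inner ℝ (matVec (L t) (f t)) (f t)) (c := c ^ 2)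
    (fun k => (integrable_norm_sq _).add (integrable_L _ _))
    (fun k => Eventually.of_forall fun t => add_nonneg (sq_nonneg _) (inner_matVec_nonneg hL t _))
    (fun k => by
      rw [← norm_sq_eq_integral]
      exact pow_le_pow_left₀ (norm_nonneg _) (hc _) 2)
    (by
      filter_upwards [haef, haeg] with t htf htg
      exact (htg.norm.pow 2).add (((continuous_inner_matVec_self (L t)).tendsto _).comp
        (htf.comp hψ.tendsto_atTop)))
  have hmem : (f, g) ∈ xSubmodule α hL :=
    ⟨(Submodule.isClosed_topologicalClosure _).mem_of_tendsto (hf.prodMk_nhds hg)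
      (Eventually.of_forall fun k => (u k).2.1),
    (hint.sub (integrable_norm_sq g)).congr (Eventually.of_forall fun t => add_sub_cancel_left _ _)⟩
  let x : XSpace α hL := ⟨(f, g), hmem⟩
  exact ⟨x, rfl, rfl, (sq_le_sq₀ (norm_nonneg _) hc0).1 ((norm_sq_eq_integral x).trans_le hle)⟩

instance completeSpace : CompleteSpace (XSpace α hL) := by
  refine Metric.complete_of_cauchySeq_tendsto fun u hu => ?_
  obtain ⟨f, hf⟩ := cauchySeq_tendsto_of_complete
    ((fnL (α := α) (hL := hL)).uniformContinuous.comp_cauchySeq hu)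
  obtain ⟨g, hg⟩ := cauchySeq_tendsto_of_complete
    ((DL (α := α) (hL := hL)).uniformContinuous.comp_cauchySeq hu)
  obtain ⟨M, hM⟩ := hu.norm_bddAbove
  obtain ⟨x, rfl, rfl, -⟩ := exists_norm_le_of_tendsto (fun k => hM ⟨k, rfl⟩) hf hg
  refine ⟨x, Metric.tendsto_atTop'.2 fun ε hε => ?_⟩
  obtain ⟨N, hN⟩ := Metric.cauchySeq_iff.1 hu (ε / 2) (half_pos hε)
  refine ⟨N, fun k hk => ?_⟩
  obtain ⟨y, hyf, hyD, hy⟩ := exists_norm_le_of_tendsto (u := fun m => u k - u (m + N))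
    (fun m => by simpa only [dist_eq_norm] using (hN k hk.le _ (Nat.le_add_left N m)).le)
    (tendsto_const_nhds.sub (hf.comp (tendsto_add_atTop_nat N)))
    (tendsto_const_nhds.sub (hg.comp (tendsto_add_atTop_nat N)))
  have hyx : y = u k - x := ext_pair hyf hyD
  rw [dist_eq_norm, ← hyx]
  exact hy.trans_lt (half_lt_self hε)

section Embeddings

theorem ae_norm_sub_average_fn_le (hα : 1 / 2 < α) (hα' : α < 1) {r : ℝ} (hr : 0 < r)
    (u : XSpace α hL) :
    ∀ᵐ t, ‖u.fn t - average r u.fn t‖ ≤ holderConst α * r ^ (α - 1 / 2) * ‖u‖ := by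
  filter_upwards [ae_norm_sub_average_le hα hα' u.2.1 hr] with t ht
  refine ht.trans (mul_le_mul_of_nonneg_left (norm_D_le u) ?_)
  exact mul_nonneg (holderConst_nonneg (by linarith)) (Real.rpow_nonneg hr.le _)

theorem exists_forall_norm_sub_average_le (hα : 1 / 2 < α) (hα' : α < 1) (hL : CondL L) (M : ℝ)
    {ε : ℝ} (hε : 0 < ε) :
    ∃ r > 0, ∀ u : XSpace α hL, ‖u‖ ≤ M → ∀ᵐ t, ‖u.fn t - average r u.fn t‖ ≤ ε := by
  have hexp : 0 < α - 1 / 2 := by linarith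
  have hlim : Tendsto (fun r : ℝ => holderConst α * r ^ (α - 1 / 2) * M) (𝓝[>] 0) (𝓝 0) := by
    have h := ((Real.continuousAt_rpow_const 0 _ (Or.inr hexp.le)).tendsto.const_mul
      (holderConst α)).mul_const M
    rw [Real.zero_rpow hexp.ne', mul_zero, zero_mul] at h
    exact h.mono_left nhdsWithin_le_nhds
  obtain ⟨r, hrε, hr⟩ := ((hlim.eventually (ge_mem_nhds hε)).and self_mem_nhdsWithin).exists
  refine ⟨r, hr, fun u hu => ?_⟩
  filter_upwards [ae_norm_sub_average_fn_le hα hα' hr u] with t ht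
  refine (ht.trans (mul_le_mul_of_nonneg_left hu ?_)).trans hrε
  exact mul_nonneg (holderConst_nonneg (by linarith)) (Real.rpow_nonneg (le_of_lt hr) _)

theorem exists_ae_norm_le (hα : 1 / 2 < α) (hα' : α < 1) (hL : CondL L) :
    ∃ C > 0, ∀ u : XSpace α hL, ∀ᵐ t, ‖u.fn t‖ ≤ C * ‖u‖ := by
  obtain ⟨C, hC, hfn⟩ := exists_norm_fn_le α hL
  have hH : 0 ≤ holderConst α := holderConst_nonneg (by linarith)
  refine ⟨holderConst α + C, by linarith, fun u => ?_⟩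
  filter_upwards [ae_norm_sub_average_fn_le hα hα' one_pos u] with t ht
  have hav := norm_average_le_norm zero_le_one u.fn t
  simp only [inv_one, Real.sqrt_one, one_mul, Real.one_rpow, mul_one] at hav ht
  linarith [norm_le_norm_sub_add (u.fn t) (average 1 u.fn t), hfn u]

variable (α) in
theorem exists_forall_setIntegral_norm_sq_le (hL : CondL L) (M : ℝ) {ε : ℝ} (hε : 0 < ε) :
    ∃ T : ℝ, ∀ u : XSpace α hL, ‖u‖ ≤ M → ∫ t in {t | T ≤ |t|}, ‖u.fn t‖ ^ 2 ≤ ε := by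
  obtain ⟨T, hT⟩ := hL.exists_lower_bound_at_infinity ((M ^ 2 + 1) / ε)
  refine ⟨T, fun u hu => ?_⟩
  have hle := mul_setIntegral_norm_sq_le (measurableSet_le measurable_const measurable_abs) hT u
  have huM := pow_le_pow_left₀ (norm_nonneg u) hu 2
  rw [div_mul_eq_mul_div, div_le_iff₀ hε] at hle
  nlinarith [sq_nonneg M]

variable (α) in
theorem exists_forall_norm_average_le (hL : CondL L) (M : ℝ) {r ε : ℝ} (hr : 0 < r)
    (hε : 0 < ε) :
    ∃ T : ℝ, ∀ u : XSpace α hL, ‖u‖ ≤ M → ∀ t, T ≤ |t| → ‖average r u.fn t‖ ≤ ε := by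
  obtain ⟨T, hT⟩ := exists_forall_setIntegral_norm_sq_le α hL M (ε := r * ε ^ 2) (by positivity)
  refine ⟨T + r, fun u hu t ht => (sq_le_sq₀ (norm_nonneg _) hε.le).1 ?_⟩
  have hsub : Set.Ioc t (t + r) ⊆ {s | T ≤ |s|} := fun s hs => by
    have htri := abs_sub_abs_le_abs_sub t s
    rw [abs_sub_comm, abs_of_pos (sub_pos.2 hs.1)] at htri
    simp only [Set.mem_ofPred_eq]
    linarith [hs.2]
  calc ‖average r u.fn t‖ ^ 2 ≤ r⁻¹ * ∫ s in Set.Ioc t (t + r), ‖u.fn s‖ ^ 2 :=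
        norm_average_sq_le hr.le u.fn t
    _ ≤ r⁻¹ * ∫ s in {s | T ≤ |s|}, ‖u.fn s‖ ^ 2 := by
        gcongr
        · exact Eventually.of_forall fun s => sq_nonneg _
        · exact (integrable_norm_sq u.fn).integrableOn
    _ ≤ r⁻¹ * (r * ε ^ 2) := by gcongr; exact hT u hu
    _ = ε ^ 2 := inv_mul_cancel_left₀ hr.ne' _

theorem exists_uniform_decay (hα : 1 / 2 < α) (hα' : α < 1) (hL : CondL L) (M : ℝ) {δ : ℝ}
    (hδ : 0 < δ) :
    ∃ T : ℝ, ∀ u : XSpace α hL, ‖u‖ ≤ M → ∀ᵐ t, T ≤ |t| → ‖u.fn t‖ ≤ δ := by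
  obtain ⟨r, hr, hsub⟩ := exists_forall_norm_sub_average_le hα hα' hL M (half_pos hδ)
  obtain ⟨T, hT⟩ := exists_forall_norm_average_le α hL M hr (half_pos hδ)
  refine ⟨T, fun u hu => ?_⟩
  filter_upwards [hsub u hu] with t ht htT
  linarith [norm_le_norm_sub_add (u.fn t) (average r u.fn t), hT u hu t htT]

theorem exists_tendsto_average_of_tendsto_inner {u : ℕ → L2 n}
    (hu : ∀ w, ∃ l, Tendsto (fun k => inner ℝ w (u k)) atTop (𝓝 l)) (r t : ℝ) :
    ∃ x, Tendsto (fun k => average r (u k) t) atTop (𝓝 x) := by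
  choose l hl using fun i => hu (indicatorConstLp 2 measurableSet_Ioc
    (measure_Ioc_lt_top (a := t) (b := t + r)).ne (EuclideanSpace.single i 1))
  have hpi : Tendsto (fun k => (∫ s in Set.Ioc t (t + r), u k s).ofLp) atTop (𝓝 l) := by
    refine tendsto_pi_nhds.2 fun i => (hl i).congr fun k => ?_
    rw [L2.inner_indicatorConstLp_eq_inner_setIntegral, EuclideanSpace.inner_single_left]
    simp
  simp only [average, setAverage_eq]
  exact ⟨_, (((PiLp.continuous_toLp 2 _).tendsto _).comp hpi).const_smul _⟩

theorem exists_subseq_ae_tendsto_of_norm_le (hα : 1 / 2 < α) (hα' : α < 1)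
    {u : ℕ → XSpace α hL} {M : ℝ} (hu : ∀ k, ‖u k‖ ≤ M) :
    ∃ φ : ℕ → ℕ, StrictMono φ ∧
      ∀ᵐ t, ∃ x, Tendsto (fun k => (u (φ k)).fn t) atTop (𝓝 x) := by
  have : Fact ((2 : ENNReal) ≠ ⊤) := ⟨ENNReal.ofNat_ne_top⟩
  obtain ⟨C, hC, hfn⟩ := exists_norm_fn_le α hL
  obtain ⟨φ, hφ, hweak⟩ := exists_subseq_tendsto_inner (u := fun k => (u k).fn) (M := C * M)
    fun k => (hfn _).trans (by gcongr; exact hu k)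
  refine ⟨φ, hφ, ?_⟩
  choose r _ hsub using fun j : ℕ => exists_forall_norm_sub_average_le hα hα' hL M
    (Nat.one_div_pos_of_nat (α := ℝ) (n := j))
  filter_upwards [ae_all_iff.2 fun k => ae_all_iff.2 fun j => hsub j (u (φ k)) (hu _)] with t ht
  refine cauchySeq_tendsto_of_complete (cauchySeq_of_forall_dist_le fun ε hε => ?_)
  obtain ⟨j, hj⟩ := exists_nat_one_div_lt hε
  obtain ⟨x, hx⟩ := exists_tendsto_average_of_tendsto_inner hweak (r j) t
  exact ⟨_, hx.cauchySeq, fun k => by simpa only [dist_eq_norm] using (ht k j).trans hj.le⟩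

theorem unifIntegrable_fn (hα : 1 / 2 < α) (hα' : α < 1) {ι : Type*} {u : ι → XSpace α hL}
    {M : ℝ} (hu : ∀ i, ‖u i‖ ≤ M) : UnifIntegrable (fun i => (u i).fn) 2 volume := by
  obtain ⟨C, hC, hbound⟩ := exists_ae_norm_le hα hα' hL
  refine unifIntegrable_of_ae_norm_le one_le_two ENNReal.ofNat_ne_top
    (fun i => Lp.aestronglyMeasurable _) (C := C * M) fun i => ?_
  filter_upwards [hbound (u i)] with t ht
  exact ht.trans (by gcongr; exact hu i)

theorem unifTight_fn {ι : Type*} {u : ι → XSpace α hL} {M : ℝ} (hu : ∀ i, ‖u i‖ ≤ M) :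
    UnifTight (fun i => (u i).fn) 2 volume := by
  refine unifTight_iff_real _ _ _ |>.2 fun ε hε => ?_
  obtain ⟨T, hT⟩ := exists_forall_setIntegral_norm_sq_le α hL M (pow_pos hε 2)
  have hmeas : MeasurableSet {t : ℝ | T ≤ |t|} := measurableSet_le measurable_const measurable_abs
  refine ⟨{t : ℝ | T ≤ |t|}ᶜ, ?_, fun i => ?_⟩
  · refine ((Metric.isBounded_Ioo (-T) T).subset fun t ht => ?_).measure_lt_top.ne
    exact abs_lt.1 (not_le.1 ht)
  · rw [compl_compl]
    exact eLpNorm_two_indicator_le (Lp.memLp _) hmeas (hT (u i) (hu i)) hε.le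

theorem exists_subseq_tendsto_fn (hα : 1 / 2 < α) (hα' : α < 1) {u : ℕ → XSpace α hL} {M : ℝ}
    (hu : ∀ k, ‖u k‖ ≤ M) :
    ∃ φ : ℕ → ℕ, StrictMono φ ∧ ∃ w, Tendsto (fun k => (u (φ k)).fn) atTop (𝓝 w) := by
  obtain ⟨C, hC, hfn⟩ := exists_norm_fn_le α hL
  obtain ⟨φ, hφ, hae⟩ := exists_subseq_ae_tendsto_of_norm_le hα hα' hu
  obtain ⟨w, hw⟩ := exists_Lp_ae_tendsto (u := fun k => (u (φ k)).fn) (M := C * M)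
    (fun k => (hfn _).trans (by gcongr; exact hu _)) hae
  exact ⟨φ, hφ, w, Lp_tendsto_of_ae_tendsto ENNReal.ofNat_ne_top
    (unifIntegrable_fn hα hα' fun k => hu (φ k)) (unifTight_fn fun k => hu (φ k)) hw⟩

end Embeddings

end XSpace

section Calculus

theorem hasFDerivAt_of_hasLineDerivAt {E F : Type*} [NormedAddCommGroup E] [NormedSpace ℝ E]
    [NormedAddCommGroup F] [NormedSpace ℝ F] {f : E → F} {f' : E → E →L[ℝ] F}
    (hf : ∀ u v, HasLineDerivAt ℝ f (f' u v) u v) (hf' : Continuous f') (u : E) :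
    HasFDerivAt f (f' u) u := by
  have hline : ∀ (v : E) (s : ℝ), HasDerivAt (fun s : ℝ => f (u + s • v)) (f' (u + s • v) v) s := by
    intro v s
    have h0 : HasDerivAt (fun r : ℝ => f (u + s • v + r • v)) (f' (u + s • v) v) (s - s) := by
      rw [sub_self]
      exact hf (u + s • v) v
    refine (HasDerivAt.comp_sub_const s s h0).congr_of_eventuallyEq (.of_forall fun r => ?_)
    simp only [add_assoc, ← add_smul, add_sub_cancel]
  rw [hasFDerivAt_iff_isLittleO_nhds_zero, Asymptotics.isLittleO_iff]
  intro c hc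
  obtain ⟨δ, hδ, hcont⟩ := Metric.continuousAt_iff.1 (hf'.continuousAt (x := u)) c hc
  filter_upwards [Metric.ball_mem_nhds (0 : E) hδ] with v hv
  rw [mem_ball_zero_iff] at hv
  have hsub : ∀ s : ℝ, HasDerivAt (fun s : ℝ => f (u + s • v) - s • f' u v)
      (f' (u + s • v) v - f' u v) s := fun s => by
    have hdiff := (hline v s).sub ((hasDerivAt_id s).smul_const (f' u v))
    rwa [one_smul] at hdiff
  have hbound : ∀ s ∈ Set.Ico (0 : ℝ) 1, ‖f' (u + s • v) v - f' u v‖ ≤ c * ‖v‖ := fun s hs => by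
    have hdist : dist (u + s • v) u < δ := by
      rw [dist_self_add_left, norm_smul, Real.norm_of_nonneg hs.1]
      exact (mul_le_of_le_one_left (norm_nonneg _) hs.2.le).trans_lt hv
    refine (f' (u + s • v) - f' u).le_of_opNorm_le ?_ v
    rw [← dist_eq_norm]
    exact (hcont hdist).le
  simpa [sub_right_comm] using norm_image_sub_le_of_norm_deriv_le_segment_01'
    (fun s _ => (hsub s).hasDerivWithinAt) hbound

variable {E : Type*} [NormedAddCommGroup E] [InnerProductSpace ℝ E] [CompleteSpace E]

theorem hasDerivAt_apply_add_smul {V : E → ℝ} (hV : Differentiable ℝ V) (x y : E) (s : ℝ) :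
    HasDerivAt (fun s : ℝ => V (x + s • y)) (inner ℝ (gradient V (x + s • y)) y) s := by
  have hline : HasDerivAt (fun s : ℝ => x + s • y) y s := by
    simpa using ((hasDerivAt_id s).smul_const y).const_add x
  have hcomp := (hV (x + s • y)).hasGradientAt.hasFDerivAt.comp_hasDerivAt s hline
  rwa [InnerProductSpace.toDual_apply_apply] at hcomp

theorem monotoneOn_rpow_neg_mul_apply_smul {V : E → ℝ} (hV : Differentiable ℝ V) {μ : ℝ}
    (hμ : ∀ x, μ * V x ≤ inner ℝ x (gradient V x)) (x : E) :
    MonotoneOn (fun r : ℝ => r ^ (-μ) * V (r • x)) (Set.Ioi 0) := by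
  have hderiv : ∀ r ∈ Set.Ioi (0 : ℝ), HasDerivAt (fun r : ℝ => r ^ (-μ) * V (r • x))
      (-μ * r ^ (-μ - 1) * V (r • x) + r ^ (-μ) * inner ℝ (gradient V (r • x)) x) r := by
    intro r hr
    have hray := hasDerivAt_apply_add_smul hV 0 x r
    simp only [zero_add] at hray
    exact (Real.hasDerivAt_rpow_const (Or.inl (ne_of_gt hr))).mul hray
  refine monotoneOn_of_hasDerivWithinAt_nonneg (convex_Ioi 0)
    (fun r hr => (hderiv r hr).continuousAt.continuousWithinAt)
    (fun r hr => (hderiv r (interior_subset hr)).hasDerivWithinAt) fun r hr => ?_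
  replace hr : 0 < r := interior_subset hr
  have hrx := hμ (r • x)
  rw [real_inner_comm, inner_smul_right] at hrx
  have hfactor : -μ * r ^ (-μ - 1) * V (r • x) + r ^ (-μ) * inner ℝ (gradient V (r • x)) x =
      r ^ (-μ - 1) * (r * inner ℝ (gradient V (r • x)) x - μ * V (r • x)) := by
    rw [show r ^ (-μ) = r ^ (-μ - 1) * r by rw [← Real.rpow_add_one hr.ne', sub_add_cancel]]
    ring
  rw [hfactor]
  exact mul_nonneg (Real.rpow_nonneg hr.le _) (sub_nonneg.2 hrx)

theorem rpow_mul_le_apply_smul {V : E → ℝ} (hV : Differentiable ℝ V) {μ : ℝ}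
    (hμ : ∀ x, μ * V x ≤ inner ℝ x (gradient V x)) (x : E) {s : ℝ} (hs : 1 ≤ s) :
    s ^ μ * V x ≤ V (s • x) := by
  have hs0 : 0 < s := zero_lt_one.trans_le hs
  have hmono := monotoneOn_rpow_neg_mul_apply_smul hV hμ x (Set.mem_Ioi.2 one_pos)
    (Set.mem_Ioi.2 hs0) hs
  simp only [Real.one_rpow, one_mul, one_smul, Real.rpow_neg hs0.le] at hmono
  rwa [le_inv_mul_iff₀ (Real.rpow_pos_of_pos hs0 _)] at hmono

end Calculus

section Potential

variable {E : Type*} [NormedAddCommGroup E] [InnerProductSpace ℝ E]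
  {W : ℝ → E → ℝ}

theorem hasFDerivAt_potential (hW : ContDiff ℝ 1 fun p : ℝ × E => W p.1 p.2) (t : ℝ) (x : E) :
    HasFDerivAt (W t) ((fderiv ℝ (fun p : ℝ × E => W p.1 p.2) (t, x)).comp
      (ContinuousLinearMap.inr ℝ ℝ E)) x :=
  (hW.differentiable one_ne_zero (t, x)).hasFDerivAt.comp x (hasFDerivAt_prodMk_right t x)

theorem differentiable_potential (hW : ContDiff ℝ 1 fun p : ℝ × E => W p.1 p.2) (t : ℝ) :
    Differentiable ℝ (W t) := fun x =>
  (hasFDerivAt_potential hW t x).differentiableAt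

theorem aestronglyMeasurable_potential (hW : ContDiff ℝ 1 fun p : ℝ × E => W p.1 p.2)
    {μ : Measure ℝ} {f : ℝ → E} (hf : AEStronglyMeasurable f μ) :
    AEStronglyMeasurable (fun t => W t (f t)) μ :=
  hW.continuous.comp_aestronglyMeasurable (aestronglyMeasurable_id.prodMk hf)

variable [CompleteSpace E]

theorem continuous_gradient_potential (hW : ContDiff ℝ 1 fun p : ℝ × E => W p.1 p.2) :
    Continuous fun p : ℝ × E => gradient (W p.1) p.2 := by
  have hgrad : ∀ p : ℝ × E, gradient (W p.1) p.2 = (InnerProductSpace.toDual ℝ E).symm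
      ((fderiv ℝ (fun p : ℝ × E => W p.1 p.2) p).comp (ContinuousLinearMap.inr ℝ ℝ E)) :=
    fun p => by rw [gradient, (hasFDerivAt_potential hW p.1 p.2).fderiv]
  simp only [hgrad]
  exact (LinearIsometryEquiv.continuous _).comp
    ((hW.continuous_fderiv one_ne_zero).clm_comp continuous_const)

theorem aestronglyMeasurable_gradient (hW : ContDiff ℝ 1 fun p : ℝ × E => W p.1 p.2)
    {μ : Measure ℝ} {f : ℝ → E} (hf : AEStronglyMeasurable f μ) :
    AEStronglyMeasurable (fun t => gradient (W t) (f t)) μ :=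
  (continuous_gradient_potential hW).comp_aestronglyMeasurable
    (aestronglyMeasurable_id.prodMk hf)

end Potential

section Conditions

variable {n : ℕ} {W : ℝ → Vec n → ℝ}

theorem CondW1.pos (hW1 : CondW1 W) (t : ℝ) {x : Vec n} (hx : x ≠ 0) : 0 < W t x := by
  obtain ⟨-, μ, hμ, hAR⟩ := hW1
  exact pos_of_mul_pos_right (hAR t x hx).1 (by linarith)

theorem dense_compl_zero (hn : 1 ≤ n) : Dense ({0}ᶜ : Set (Vec n)) := by
  have : Nonempty (Fin n) := ⟨⟨0, hn⟩⟩
  have : (𝓝[≠] (0 : Vec n)).NeBot := Module.punctured_nhds_neBot ℝ (Vec n) 0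
  exact dense_compl_singleton 0

theorem CondW1.nonneg (hn : 1 ≤ n) (hW1 : CondW1 W) (t : ℝ) (x : Vec n) : 0 ≤ W t x :=
  (dense_compl_zero hn).induction (fun _ hx => (hW1.pos t hx).le)
    (isClosed_le continuous_const (differentiable_potential hW1.1 t).continuous) x

theorem CondW1.exists_superquadratic (hn : 1 ≤ n) (hW1 : CondW1 W) :
    ∃ μ > 2, ∀ t x, μ * W t x ≤ inner ℝ x (gradient (W t) x) := by
  obtain ⟨hW, μ, hμ, hAR⟩ := hW1
  refine ⟨μ, hμ, fun t x => (dense_compl_zero hn).induction (fun x hx => (hAR t x hx).2) ?_ x⟩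
  exact isClosed_le (continuous_const.mul (differentiable_potential hW t).continuous)
    (continuous_id.inner ((continuous_gradient_potential hW).comp (Continuous.prodMk_right t)))

theorem CondW1.abs_le (hn : 1 ≤ n) (hW1 : CondW1 W) (t : ℝ) (x : Vec n) :
    |W t x| ≤ ‖x‖ * ‖gradient (W t) x‖ := by
  obtain ⟨μ, hμ, hAR⟩ := hW1.exists_superquadratic hn
  have h0 := hW1.nonneg hn t x
  rw [abs_of_nonneg h0]
  calc W t x ≤ μ * W t x := le_mul_of_one_le_left h0 (by linarith)
    _ ≤ inner ℝ x (gradient (W t) x) := hAR t x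
    _ ≤ ‖x‖ * ‖gradient (W t) x‖ := real_inner_le_norm _ _

theorem CondW1.apply_zero (hn : 1 ≤ n) (hW1 : CondW1 W) (t : ℝ) : W t 0 = 0 := by
  simpa using hW1.abs_le hn t 0

theorem CondW2.exists_linear_growth (hW2 : CondW2 W)
    (hW : ContDiff ℝ 1 fun p : ℝ × Vec n => W p.1 p.2) :
    ∃ δ > 0, ∀ R T : ℝ, ∃ C > 0, ∀ (t : ℝ) (x : Vec n), ‖x‖ ≤ R → (T ≤ |t| → ‖x‖ < δ) →
      ‖gradient (W t) x‖ ≤ C * ‖x‖ := by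
  obtain ⟨δ, hδ, hsmall⟩ := hW2 1 one_pos
  refine ⟨δ, hδ, fun R T => ?_⟩
  obtain ⟨B, hB⟩ := ((isCompact_Icc (a := -T) (b := T)).prod
    (isCompact_closedBall (0 : Vec n) R)).exists_bound_of_continuousOn
    (continuous_gradient_potential hW).continuousOn
  refine ⟨max 1 (B / δ), by positivity, fun t x hx ht => ?_⟩
  rcases lt_or_ge ‖x‖ δ with hxδ | hxδ
  · exact (hsmall t x hxδ).trans (by gcongr; exact le_max_left _ _)
  · have htT : |t| ≤ T := le_of_not_ge fun hge => hxδ.not_gt (ht hge)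
    have hBtx : ‖gradient (W t) x‖ ≤ B := hB (t, x) ⟨abs_le.1 htT, by simpa using hx⟩
    have hB0 : 0 ≤ B := (norm_nonneg _).trans hBtx
    calc ‖gradient (W t) x‖ ≤ B := hBtx
      _ = B / δ * δ := by field_simp
      _ ≤ B / δ * ‖x‖ := by gcongr
      _ ≤ max 1 (B / δ) * ‖x‖ := by gcongr; exact le_max_right _ _

end Conditions

section Domination

variable {Ω : Type*} [MeasurableSpace Ω] {μ : Measure Ω} {E F : Type*} [NormedAddCommGroup E]
  [NormedAddCommGroup F] {p : ENNReal} {C : ℝ}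

theorem eLpNorm_indicator_le_mul {f : Ω → E} {g : Ω → F} (hC : ∀ᵐ x ∂μ, ‖g x‖ ≤ C * ‖f x‖)
    (s : Set Ω) : eLpNorm (s.indicator g) p μ ≤ ENNReal.ofReal C * eLpNorm (s.indicator f) p μ := by
  refine eLpNorm_le_mul_eLpNorm_of_ae_le_mul ?_ p
  filter_upwards [hC] with x hx
  by_cases hxs : x ∈ s <;> simp [hxs, hx]

variable {ι : Type*} {f : ι → Ω → E} {g : ι → Ω → F}

theorem unifIntegrable_of_ae_le_mul (hf : UnifIntegrable f p μ) (hC0 : 0 < C)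
    (hC : ∀ i, ∀ᵐ x ∂μ, ‖g i x‖ ≤ C * ‖f i x‖) : UnifIntegrable g p μ := fun ε hε => by
  obtain ⟨δ, hδ, hfδ⟩ := hf (div_pos hε hC0)
  refine ⟨δ, hδ, fun i s hs hμs => (eLpNorm_indicator_le_mul (hC i) s).trans ?_⟩
  calc ENNReal.ofReal C * eLpNorm (s.indicator (f i)) p μ
      ≤ ENNReal.ofReal C * ENNReal.ofReal (ε / C) := by gcongr; exact hfδ i s hs hμs
    _ = ENNReal.ofReal ε := by rw [← ENNReal.ofReal_mul hC0.le, mul_div_cancel₀ _ hC0.ne']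

theorem unifTight_of_ae_le_mul (hf : UnifTight f p μ) (hC0 : 0 < C)
    (hC : ∀ i, ∀ᵐ x ∂μ, ‖g i x‖ ≤ C * ‖f i x‖) : UnifTight g p μ := by
  refine (unifTight_iff_real _ _ _).2 fun ε hε => ?_
  obtain ⟨s, hs, hfs⟩ := (unifTight_iff_real _ _ _).1 hf (div_pos hε hC0)
  refine ⟨s, hs, fun i => (eLpNorm_indicator_le_mul (hC i) sᶜ).trans ?_⟩
  calc ENNReal.ofReal C * eLpNorm (sᶜ.indicator (f i)) p μ
      ≤ ENNReal.ofReal C * ENNReal.ofReal (ε / C) := by gcongr; exact hfs i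
    _ = ENNReal.ofReal ε := by rw [← ENNReal.ofReal_mul hC0.le, mul_div_cancel₀ _ hC0.ne']

end Domination

section Nemytskii

variable {Ω : Type*} [MeasurableSpace Ω] {μ : Measure Ω} {E F : Type*} [NormedAddCommGroup E]
  [NormedAddCommGroup F] {p : ENNReal} {g : Ω → E → F}

open Classical in
/-- The superposition (Nemytskii) operator `u ↦ g(·, u(·))` on `L^p`, with the junk value `0` where
`g(·, u(·))` is not in `L^p`. -/
def nemytskii (g : Ω → E → F) (u : Lp E p μ) : Lp F p μ :=
  if h : MemLp (fun x => g x (u x)) p μ then h.toLp else 0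

theorem coeFn_nemytskii {u : Lp E p μ} (hu : MemLp (fun x => g x (u x)) p μ) :
    nemytskii g u =ᵐ[μ] fun x => g x (u x) := by
  rw [nemytskii, dif_pos hu]
  exact hu.coeFn_toLp

variable {u : ℕ → Lp E p μ} {w : Lp E p μ} {C : ℝ}

theorem memLp_of_ae_tendsto_of_ae_le_mul (hg : ∀ x, Continuous (g x))
    (hmem : ∀ k, MemLp (fun x => g x (u k x)) p μ)
    (hC : ∀ k, ∀ᵐ x ∂μ, ‖g x (u k x)‖ ≤ C * ‖u k x‖)
    (hlim : ∀ᵐ x ∂μ, Tendsto (fun k => u k x) atTop (𝓝 (w x))) :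
    MemLp (fun x => g x (w x)) p μ := by
  have hglim : ∀ᵐ x ∂μ, Tendsto (fun k => g x (u k x)) atTop (𝓝 (g x (w x))) := by
    filter_upwards [hlim] with x hx using ((hg x).tendsto _).comp hx
  refine (Lp.memLp w).of_le_mul (c := C)
    (aestronglyMeasurable_of_tendsto_ae _ (fun k => (hmem k).1) hglim) ?_
  filter_upwards [hlim, hglim, ae_all_iff.2 hC] with x hx hgx hCx
  exact le_of_tendsto_of_tendsto' hgx.norm (hx.norm.const_mul C) hCx

variable [Fact (1 ≤ p)]

theorem tendsto_nemytskii (hp : p ≠ ⊤) (hg : ∀ x, Continuous (g x)) (hu : Tendsto u atTop (𝓝 w))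
    (hmem : ∀ k, MemLp (fun x => g x (u k x)) p μ) (hC0 : 0 < C)
    (hC : ∀ k, ∀ᵐ x ∂μ, ‖g x (u k x)‖ ≤ C * ‖u k x‖) :
    Tendsto (fun k => nemytskii g (u k)) atTop (𝓝 (nemytskii g w)) := by
  refine tendsto_of_subseq_tendsto fun ψ hψ => ?_
  obtain ⟨φ, hφ, hae⟩ := exists_subseq_ae_tendsto (hu.comp hψ)
  have hsub : Tendsto (fun k => u (ψ (φ k))) atTop (𝓝 w) := (hu.comp hψ).comp hφ.tendsto_atTop
  obtain ⟨-, hui, hut⟩ := (tendstoInMeasure_iff_tendsto_Lp Fact.out hp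
    (fun k => Lp.memLp (u (ψ (φ k)))) (Lp.memLp w)).2
    ((Lp.tendsto_Lp_iff_tendsto_eLpNorm' _ w).1 hsub)
  have hw := memLp_of_ae_tendsto_of_ae_le_mul hg (fun k => hmem (ψ (φ k))) (fun k => hC _) hae
  have hbound : ∀ k, ∀ᵐ x ∂μ, ‖nemytskii g (u (ψ (φ k))) x‖ ≤ C * ‖u (ψ (φ k)) x‖ := fun k => by
    filter_upwards [hC (ψ (φ k)), coeFn_nemytskii (hmem (ψ (φ k)))] with x hx hN
    rwa [hN]
  refine ⟨φ, Lp_tendsto_of_ae_tendsto hp (unifIntegrable_of_ae_le_mul hui hC0 hbound)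
    (unifTight_of_ae_le_mul hut hC0 hbound) ?_⟩
  filter_upwards [hae, coeFn_nemytskii hw,
    ae_all_iff.2 fun k => coeFn_nemytskii (hmem (ψ (φ k)))] with x hx hwx hNx
  simp only [hNx, hwx]
  exact ((hg x).tendsto _).comp hx

end Nemytskii

section NemytskiiGradient

variable {n : ℕ} {α : ℝ} {L : ℝ → Matrix (Fin n) (Fin n) ℝ} {hL : CondL L}
  {W : ℝ → Vec n → ℝ}

theorem exists_forall_norm_gradient_le (hα : 1 / 2 < α) (hα' : α < 1) (hL : CondL L)
    (hW : ContDiff ℝ 1 fun p : ℝ × Vec n => W p.1 p.2) (hW2 : CondW2 W) (M : ℝ) :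
    ∃ C > 0, ∀ u v : XSpace α hL, ‖u‖ ≤ M → ‖v‖ ≤ M →
      ∀ᵐ t, ∀ x, ‖x‖ ≤ ‖u.fn t‖ + ‖v.fn t‖ → ‖gradient (W t) x‖ ≤ C * ‖x‖ := by
  obtain ⟨δ, hδ, hgrowth⟩ := hW2.exists_linear_growth hW
  obtain ⟨K, hK, hsup⟩ := XSpace.exists_ae_norm_le hα hα' hL
  obtain ⟨T, hT⟩ := XSpace.exists_uniform_decay hα hα' hL M (show 0 < δ / 3 by positivity)
  obtain ⟨C, hC, hgrad⟩ := hgrowth (2 * (K * M)) T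
  refine ⟨C, hC, fun u v hu hv => ?_⟩
  filter_upwards [hsup u, hsup v, hT u hu, hT v hv] with t hut hvt hTu hTv x hx
  refine hgrad t x ?_ fun ht => by linarith [hTu ht, hTv ht]
  linarith [mul_le_mul_of_nonneg_left hu hK.le, mul_le_mul_of_nonneg_left hv hK.le]

theorem memLp_gradient (hα : 1 / 2 < α) (hα' : α < 1)
    (hW : ContDiff ℝ 1 fun p : ℝ × Vec n => W p.1 p.2) (hW2 : CondW2 W) (u : XSpace α hL) :
    MemLp (fun t => gradient (W t) (u.fn t)) 2 := by
  obtain ⟨C, -, hC⟩ := exists_forall_norm_gradient_le hα hα' hL hW hW2 ‖u‖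
  refine (Lp.memLp u.fn).of_le_mul (c := C)
    (aestronglyMeasurable_gradient hW (Lp.aestronglyMeasurable _)) ?_
  filter_upwards [hC u u le_rfl le_rfl] with t ht
  exact ht _ (le_add_of_nonneg_right (norm_nonneg _))

theorem integrable_potential (hn : 1 ≤ n) (hα : 1 / 2 < α) (hα' : α < 1) (hW1 : CondW1 W)
    (hW2 : CondW2 W) (u : XSpace α hL) : Integrable fun t => W t (u.fn t) :=
  ((Lp.memLp u.fn).norm.integrable_mul (memLp_gradient hα hα' hW1.1 hW2 u).norm).mono'
    (aestronglyMeasurable_potential hW1.1 (Lp.aestronglyMeasurable _))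
    (.of_forall fun t => hW1.abs_le hn t _)

theorem tendsto_nemytskii_gradient (hα : 1 / 2 < α) (hα' : α < 1)
    (hW : ContDiff ℝ 1 fun p : ℝ × Vec n => W p.1 p.2) (hW2 : CondW2 W) {u : ℕ → XSpace α hL}
    {M : ℝ} (hM : ∀ k, ‖u k‖ ≤ M) {w : L2 n} (hu : Tendsto (fun k => (u k).fn) atTop (𝓝 w)) :
    Tendsto (fun k => nemytskii (fun t => gradient (W t)) (u k).fn) atTop
      (𝓝 (nemytskii (fun t => gradient (W t)) w)) := by
  obtain ⟨C, hC0, hC⟩ := exists_forall_norm_gradient_le hα hα' hL hW hW2 M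
  refine tendsto_nemytskii ENNReal.ofNat_ne_top
    (fun t => (continuous_gradient_potential hW).comp (Continuous.prodMk_right t)) hu
    (fun k => memLp_gradient hα hα' hW hW2 (u k)) hC0 fun k => ?_
  filter_upwards [hC (u k) (u k) (hM k) (hM k)] with t ht
  exact ht _ (le_add_of_nonneg_right (norm_nonneg _))

theorem continuous_nemytskii_gradient (hα : 1 / 2 < α) (hα' : α < 1)
    (hW : ContDiff ℝ 1 fun p : ℝ × Vec n => W p.1 p.2) (hW2 : CondW2 W) :
    Continuous fun u : XSpace α hL => nemytskii (fun t => gradient (W t)) u.fn := by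
  refine continuous_iff_seqContinuous.2 fun u v huv => ?_
  obtain ⟨M, hM⟩ := huv.norm.bddAbove_range
  exact tendsto_nemytskii_gradient hα hα' hW hW2 (fun k => hM ⟨k, rfl⟩)
    ((XSpace.fnL.continuous.tendsto v).comp huv)

end NemytskiiGradient

section Energy

variable {n : ℕ} {α : ℝ} {L : ℝ → Matrix (Fin n) (Fin n) ℝ} {hL : CondL L}
  {W : ℝ → Vec n → ℝ}

theorem hasDerivAt_integral_potential_add_smul
    (hW : ContDiff ℝ 1 fun p : ℝ × Vec n => W p.1 p.2) {u v : L2 n} {C : ℝ} (hC0 : 0 < C)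
    (hC : ∀ᵐ t, ∀ x, ‖x‖ ≤ ‖u t‖ + ‖v t‖ → ‖gradient (W t) x‖ ≤ C * ‖x‖)
    (hInt : Integrable fun t => W t (u t)) :
    HasDerivAt (fun s : ℝ => ∫ t, W t (u t + s • v t))
      (∫ t, inner ℝ (gradient (W t) (u t)) (v t)) 0 := by
  have hmeas : ∀ s : ℝ, AEStronglyMeasurable (fun t => u t + s • v t) volume := fun s =>
    (Lp.aestronglyMeasurable u).add ((Lp.aestronglyMeasurable v).const_smul s)
  have hbound : Integrable fun t => C * (‖u t‖ + ‖v t‖) * ‖v t‖ :=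
    (((Lp.memLp u).norm.add (Lp.memLp v).norm).const_mul C).integrable_mul (Lp.memLp v).norm
  have hdom : ∀ᵐ t, ∀ s ∈ Metric.ball (0 : ℝ) 1,
      ‖inner ℝ (gradient (W t) (u t + s • v t)) (v t)‖ ≤ C * (‖u t‖ + ‖v t‖) * ‖v t‖ := by
    filter_upwards [hC] with t ht s hs
    have hs1 : ‖s‖ ≤ 1 := (mem_ball_zero_iff.1 hs).le
    have hx : ‖u t + s • v t‖ ≤ ‖u t‖ + ‖v t‖ := (norm_add_le _ _).trans <| by
      rw [norm_smul]
      gcongr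
      exact mul_le_of_le_one_left (norm_nonneg _) hs1
    calc ‖inner ℝ (gradient (W t) (u t + s • v t)) (v t)‖
        ≤ ‖gradient (W t) (u t + s • v t)‖ * ‖v t‖ := norm_inner_le_norm _ _
      _ ≤ C * ‖u t + s • v t‖ * ‖v t‖ := by gcongr; exact ht _ hx
      _ ≤ C * (‖u t‖ + ‖v t‖) * ‖v t‖ := by gcongr
  have hderiv := (hasDerivAt_integral_of_dominated_loc_of_deriv_le (μ := volume)
    (F := fun (s : ℝ) t => W t (u t + s • v t))
    (F' := fun (s : ℝ) t => inner ℝ (gradient (W t) (u t + s • v t)) (v t))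
    (Metric.ball_mem_nhds (0 : ℝ) one_pos)
    (.of_forall fun s => aestronglyMeasurable_potential hW (hmeas s))
    (by simpa only [zero_smul, add_zero] using hInt)
    ((aestronglyMeasurable_gradient hW (hmeas 0)).inner (Lp.aestronglyMeasurable v)) hdom hbound
    (.of_forall fun t s _ => hasDerivAt_apply_add_smul (differentiable_potential hW t) _ _ s)).2
  simpa only [zero_smul, add_zero] using hderiv

theorem inner_nemytskii_gradient_ae_eq (hα : 1 / 2 < α) (hα' : α < 1)
    (hW : ContDiff ℝ 1 fun p : ℝ × Vec n => W p.1 p.2) (hW2 : CondW2 W) (u : XSpace α hL)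
    (v : L2 n) :
    (fun t => inner ℝ (nemytskii (fun t => gradient (W t)) u.fn t) (v t)) =ᵐ[volume]
      fun t => inner ℝ (gradient (W t) (u.fn t)) (v t) := by
  filter_upwards [coeFn_nemytskii (memLp_gradient hα hα' hW hW2 u)] with t ht
  rw [ht]

theorem inner_nemytskii_gradient (hα : 1 / 2 < α) (hα' : α < 1)
    (hW : ContDiff ℝ 1 fun p : ℝ × Vec n => W p.1 p.2) (hW2 : CondW2 W) (u : XSpace α hL)
    (v : L2 n) :
    inner ℝ (nemytskii (fun t => gradient (W t)) u.fn) v =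
      ∫ t, inner ℝ (gradient (W t) (u.fn t)) (v t) :=
  integral_congr_ae (inner_nemytskii_gradient_ae_eq hα hα' hW hW2 u v)

theorem integrable_inner_gradient (hα : 1 / 2 < α) (hα' : α < 1)
    (hW : ContDiff ℝ 1 fun p : ℝ × Vec n => W p.1 p.2) (hW2 : CondW2 W) (u : XSpace α hL)
    (v : L2 n) : Integrable fun t => inner ℝ (gradient (W t) (u.fn t)) (v t) :=
  (L2.integrable_inner (𝕜 := ℝ) _ v).congr (inner_nemytskii_gradient_ae_eq hα hα' hW hW2 u v)

/-- The gradient of the energy functional for the Hilbert space structure of `X^α`: the adjoint of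
the embedding `X^α → L²` represents `v ↦ ∫ (∇W(t, u), v) dt` by an element of `X^α`. -/
def energyGrad (W : ℝ → Vec n → ℝ) (u : XSpace α hL) : XSpace α hL :=
  u - XSpace.fnL.adjoint (nemytskii (fun t => gradient (W t)) u.fn)

theorem inner_energyGrad (u v : XSpace α hL) :
    inner ℝ (energyGrad W u) v =
      inner ℝ u v - inner ℝ (nemytskii (fun t => gradient (W t)) u.fn) v.fn := by
  rw [energyGrad, inner_sub_left, ContinuousLinearMap.adjoint_inner_left, XSpace.fnL_apply]

theorem continuous_energyGrad (hα : 1 / 2 < α) (hα' : α < 1)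
    (hW : ContDiff ℝ 1 fun p : ℝ × Vec n => W p.1 p.2) (hW2 : CondW2 W) :
    Continuous (energyGrad W : XSpace α hL → XSpace α hL) :=
  continuous_id.sub ((ContinuousLinearMap.continuous _).comp
    (continuous_nemytskii_gradient hα hα' hW hW2))

theorem energy_eq (u : XSpace α hL) :
    energy hL W u = 1 / 2 * ‖u‖ ^ 2 - ∫ t, W t (u.fn t) := by
  rw [energy, XSpace.norm_sq_eq_integral]

theorem hasLineDerivAt_integral_potential (hn : 1 ≤ n) (hα : 1 / 2 < α) (hα' : α < 1)
    (hW1 : CondW1 W) (hW2 : CondW2 W) (u v : XSpace α hL) :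
    HasLineDerivAt ℝ (fun u : XSpace α hL => ∫ t, W t (u.fn t))
      (inner ℝ (nemytskii (fun t => gradient (W t)) u.fn) v.fn) u v := by
  obtain ⟨C, hC0, hC⟩ := exists_forall_norm_gradient_le hα hα' hL hW1.1 hW2 (max ‖u‖ ‖v‖)
  have hline : ∀ s : ℝ, ∫ t, W t ((u + s • v).fn t) = ∫ t, W t (u.fn t + s • v.fn t) := fun s => by
    refine integral_congr_ae ?_
    filter_upwards [Lp.coeFn_add u.fn (s • v.fn), Lp.coeFn_smul s v.fn] with t hadd hsmul
    rw [XSpace.fn_add, XSpace.fn_smul, hadd, Pi.add_apply, hsmul, Pi.smul_apply]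
  rw [HasLineDerivAt, inner_nemytskii_gradient hα hα' hW1.1 hW2, funext hline]
  exact hasDerivAt_integral_potential_add_smul hW1.1 hC0
    (hC u v (le_max_left _ _) (le_max_right _ _)) (integrable_potential hn hα hα' hW1 hW2 u)

theorem hasGradientAt_energy (hn : 1 ≤ n) (hα : 1 / 2 < α) (hα' : α < 1)
    (hW1 : CondW1 W) (hW2 : CondW2 W) (u : XSpace α hL) :
    HasGradientAt (energy hL W) (energyGrad W u) u := by
  let N : XSpace α hL → L2 n := fun u => nemytskii (fun t => gradient (W t)) u.fn
  have hpotential : HasFDerivAt (fun u : XSpace α hL => ∫ t, W t (u.fn t))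
      ((innerSL ℝ (N u)).comp XSpace.fnL) u :=
    hasFDerivAt_of_hasLineDerivAt (f' := fun u => (innerSL ℝ (N u)).comp XSpace.fnL)
      (hasLineDerivAt_integral_potential hn hα hα' hW1 hW2)
      (((innerSL ℝ).continuous.comp (continuous_nemytskii_gradient hα hα' hW1.1 hW2)).clm_comp
        continuous_const) u
  have henergy := (((hasStrictFDerivAt_norm_sq u).hasFDerivAt.const_mul (1 / 2)).sub
    hpotential).congr_of_eventuallyEq (.of_forall energy_eq)
  refine henergy.congr_fderiv ?_
  ext v
  simp [inner_energyGrad, XSpace.fnL_apply, N]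

theorem contDiff_energy (hn : 1 ≤ n) (hα : 1 / 2 < α) (hα' : α < 1)
    (hW1 : CondW1 W) (hW2 : CondW2 W) : ContDiff ℝ 1 (energy (α := α) hL W) :=
  contDiff_one_iff_hasFDerivAt.2 ⟨_, (InnerProductSpace.toDual ℝ _).continuous.comp
    (continuous_energyGrad hα hα' hW1.1 hW2), hasGradientAt_energy hn hα hα' hW1 hW2⟩

theorem energy_of_fn_eq_zero (hn : 1 ≤ n) (hW1 : CondW1 W) {u : XSpace α hL} (hu : u.fn = 0) :
    energy hL W u = 1 / 2 * ‖u‖ ^ 2 := by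
  have hzero : ∫ t, W t (u.fn t) = 0 := by
    refine integral_eq_zero_of_ae ?_
    filter_upwards [Lp.eq_zero_iff_ae_eq_zero.1 hu] with t ht
    rw [ht, Pi.zero_apply, hW1.apply_zero hn, Pi.zero_apply]
  rw [energy_eq, hzero, sub_zero]

theorem energy_zero (hn : 1 ≤ n) (hW1 : CondW1 W) : energy (α := α) hL W 0 = 0 := by
  rw [energy_of_fn_eq_zero hn hW1 rfl, norm_zero]
  norm_num

theorem fn_ne_zero_of_energy_pos (hn : 1 ≤ n) (hW1 : CondW1 W) {u : XSpace α hL}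
    (hu : energyGrad W u = 0) (hpos : 0 < energy hL W u) : u.fn ≠ 0 := fun h0 => by
  have hcrit := inner_energyGrad (W := W) u u
  rw [hu, h0, inner_zero_left, inner_zero_right, sub_zero, real_inner_self_eq_norm_sq] at hcrit
  rw [energy_of_fn_eq_zero hn hW1 h0, ← hcrit, mul_zero] at hpos
  exact hpos.false

theorem isWeakSolution_of_energyGrad_eq_zero (hα : 1 / 2 < α) (hα' : α < 1)
    (hW : ContDiff ℝ 1 fun p : ℝ × Vec n => W p.1 p.2) (hW2 : CondW2 W) {u : XSpace α hL}
    (hu : energyGrad W u = 0) : IsWeakSolution W u := fun v => by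
  refine ⟨(u.integrable_D v).add (u.integrable_L v),
    integrable_inner_gradient hα hα' hW hW2 u v.fn, ?_⟩
  have hcrit := inner_energyGrad (W := W) u v
  rw [hu, inner_zero_left, inner_nemytskii_gradient hα hα' hW hW2] at hcrit
  exact sub_eq_zero.1 hcrit.symm

end Energy

section PalaisSmale

variable {n : ℕ} {α : ℝ} {L : ℝ → Matrix (Fin n) (Fin n) ℝ} {hL : CondL L}
  {W : ℝ → Vec n → ℝ}

theorem mul_norm_sq_le_energy_sub_inner (hn : 1 ≤ n) (hα : 1 / 2 < α) (hα' : α < 1)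
    (hW1 : CondW1 W) (hW2 : CondW2 W) {μ : ℝ}
    (hμ : ∀ t x, μ * W t x ≤ inner ℝ x (gradient (W t) x)) (u : XSpace α hL) :
    (μ / 2 - 1) * ‖u‖ ^ 2 ≤ μ * energy hL W u - inner ℝ (energyGrad W u) u := by
  have hle : μ * ∫ t, W t (u.fn t) ≤ ∫ t, inner ℝ (gradient (W t) (u.fn t)) (u.fn t) := by
    rw [← integral_const_mul]
    refine integral_mono ((integrable_potential hn hα hα' hW1 hW2 u).const_mul μ)
      (integrable_inner_gradient hα hα' hW1.1 hW2 u u.fn) fun t => ?_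
    rw [real_inner_comm]
    exact hμ t _
  rw [energy_eq, inner_energyGrad, inner_nemytskii_gradient hα hα' hW1.1 hW2,
    real_inner_self_eq_norm_sq]
  linarith

theorem le_max_of_mul_sq_le {a A B x : ℝ} (ha : 0 < a) (hA : 0 ≤ A)
    (h : a * x ^ 2 ≤ A + B * x) : x ≤ max 1 ((A + B) / a) := by
  rcases le_total x 1 with hx | hx
  · exact le_max_of_le_left hx
  · refine le_max_of_le_right ((le_div_iff₀ ha).2 ?_)
    nlinarith [mul_nonneg hA (sub_nonneg.2 hx)]

theorem exists_norm_le_of_palaisSmale (hn : 1 ≤ n) (hα : 1 / 2 < α) (hα' : α < 1)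
    (hW1 : CondW1 W) (hW2 : CondW2 W) {u : ℕ → XSpace α hL} {A B : ℝ}
    (hA : ∀ k, energy hL W (u k) ≤ A) (hB : ∀ k, ‖energyGrad W (u k)‖ ≤ B) :
    ∃ M, ∀ k, ‖u k‖ ≤ M := by
  obtain ⟨μ, hμ2, hμ⟩ := hW1.exists_superquadratic hn
  refine ⟨_, fun k => le_max_of_mul_sq_le (a := μ / 2 - 1) (A := μ * |A|) (B := B)
    (by linarith) (by positivity) ?_⟩
  calc (μ / 2 - 1) * ‖u k‖ ^ 2
      ≤ μ * energy hL W (u k) - inner ℝ (energyGrad W (u k)) (u k) :=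
        mul_norm_sq_le_energy_sub_inner hn hα hα' hW1 hW2 hμ (u k)
    _ ≤ μ * energy hL W (u k) + ‖energyGrad W (u k)‖ * ‖u k‖ := by
        linarith [neg_le_of_abs_le (abs_real_inner_le_norm (energyGrad W (u k)) (u k))]
    _ ≤ μ * |A| + B * ‖u k‖ := by
        gcongr
        · exact (hA k).trans (le_abs_self A)
        · exact hB k

theorem palaisSmale_energy (hn : 1 ≤ n) (hα : 1 / 2 < α) (hα' : α < 1) (hW1 : CondW1 W)
    (hW2 : CondW2 W) : PalaisSmale (energy (α := α) hL W) (energyGrad W) := fun u c hJ hg => by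
  obtain ⟨A, hA⟩ := hJ.bddAbove_range
  obtain ⟨B, hB⟩ := hg.norm.bddAbove_range
  obtain ⟨M, hM⟩ := exists_norm_le_of_palaisSmale hn hα hα' hW1 hW2
    (fun k => hA ⟨k, rfl⟩) (fun k => hB ⟨k, rfl⟩)
  obtain ⟨φ, hφ, w, hw⟩ := XSpace.exists_subseq_tendsto_fn hα hα' hM
  have hN := tendsto_nemytskii_gradient hα hα' hW1.1 hW2 (fun k => hM (φ k)) hw
  -- `u = ∇I(u) + ι* ∇W(·, ι u)`, and both terms on the right converge along `φ`.
  refine ⟨_, φ, hφ, ((hg.comp hφ.tendsto_atTop).add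
    (((XSpace.fnL (hL := hL)).adjoint.continuous.tendsto _).comp hN)).congr fun k => ?_⟩
  simp [energyGrad]

end PalaisSmale

section MountainPassGeometry

variable {n : ℕ} {α : ℝ} {L : ℝ → Matrix (Fin n) (Fin n) ℝ} {hL : CondL L}
  {W : ℝ → Vec n → ℝ}

theorem exists_sphere_energy_ge (hn : 1 ≤ n) (hα : 1 / 2 < α) (hα' : α < 1) (hL : CondL L)
    (hW1 : CondW1 W) (hW2 : CondW2 W) :
    ∃ ρ > 0, ∃ β > 0, ∀ w : XSpace α hL, ‖w‖ = ρ → β ≤ energy hL W w := by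
  obtain ⟨C, hC, hfn⟩ := XSpace.exists_norm_fn_le α hL
  obtain ⟨K, hK, hsup⟩ := XSpace.exists_ae_norm_le hα hα' hL
  obtain ⟨δ, hδ, hsmall⟩ := hW2 (1 / (4 * C ^ 2)) (by positivity)
  refine ⟨δ / (2 * K), by positivity, (δ / (2 * K)) ^ 2 / 4, by positivity, fun w hw => ?_⟩
  have hpotential : ∫ t, W t (w.fn t) ≤ 1 / 4 * ‖w‖ ^ 2 := calc
    ∫ t, W t (w.fn t) ≤ ∫ t, 1 / (4 * C ^ 2) * ‖w.fn t‖ ^ 2 := by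
        refine integral_mono_ae (integrable_potential hn hα hα' hW1 hW2 w)
          ((integrable_norm_sq _).const_mul _) ?_
        filter_upwards [hsup w] with t ht
        have hlt : ‖w.fn t‖ < δ := ht.trans_lt <| by
          rw [hw, show K * (δ / (2 * K)) = δ / 2 by field_simp]
          exact half_lt_self hδ
        calc W t (w.fn t) ≤ ‖w.fn t‖ * ‖gradient (W t) (w.fn t)‖ :=
              (le_abs_self _).trans (hW1.abs_le hn t _)
          _ ≤ ‖w.fn t‖ * (1 / (4 * C ^ 2) * ‖w.fn t‖) := by gcongr; exact hsmall t _ hlt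
          _ = 1 / (4 * C ^ 2) * ‖w.fn t‖ ^ 2 := by ring
    _ = 1 / (4 * C ^ 2) * ‖w.fn‖ ^ 2 := by rw [integral_const_mul, norm_sq_eq_integral]
    _ ≤ 1 / (4 * C ^ 2) * (C * ‖w‖) ^ 2 := by gcongr; exact hfn w
    _ = 1 / 4 * ‖w‖ ^ 2 := by field_simp
  rw [energy_eq, ← hw]
  linarith

theorem XSpace.exists_fn_ne_zero (hn : 1 ≤ n) (hα : 1 / 2 < α) (hα' : α < 1) (hL : CondL L) :
    ∃ u : XSpace α hL, u.fn ≠ 0 := by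
  obtain ⟨p, hp, hne⟩ := exists_mem_testGraph_fst_ne_zero (α := α) hn hα hα'
  suffices hint : Integrable fun t => inner ℝ (matVec (L t) (p.1 t)) (p.1 t) from
    ⟨⟨p, Submodule.le_topologicalClosure _ (Submodule.subset_span hp), hint⟩, hne⟩
  obtain ⟨φ, hφ, hcs, hpφ, -⟩ := hp
  have hcont : Continuous fun t => inner ℝ (matVec (L t) (φ t)) (φ t) := by
    have hentry := fun i j => hL.continuous.matrix_elem i j
    have hφc := hφ.continuous
    simp only [inner_matVec]
    fun_prop
  refine (hcont.integrable_of_hasCompactSupport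
    (hcs.mono' fun t ht => subset_closure fun h0 => ht (by simp [h0]))).congr ?_
  filter_upwards [hpφ] with t ht
  rw [ht]

theorem integral_potential_pos (hn : 1 ≤ n) (hα : 1 / 2 < α) (hα' : α < 1) (hW1 : CondW1 W)
    (hW2 : CondW2 W) {u : XSpace α hL} (hu : u.fn ≠ 0) : 0 < ∫ t, W t (u.fn t) := by
  have hnonneg : 0 ≤ fun t => W t (u.fn t) := fun t => hW1.nonneg hn t _
  refine (integral_nonneg hnonneg).lt_of_ne' fun h0 => hu (Lp.eq_zero_iff_ae_eq_zero.2 ?_)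
  filter_upwards [(integral_eq_zero_iff_of_nonneg hnonneg
    (integrable_potential hn hα hα' hW1 hW2 u)).1 h0] with t ht
  exact not_imp_comm.1 (hW1.pos t) ht.not_gt

theorem rpow_mul_integral_potential_le (hn : 1 ≤ n) (hα : 1 / 2 < α) (hα' : α < 1)
    (hW1 : CondW1 W) (hW2 : CondW2 W) {μ : ℝ}
    (hμ : ∀ t x, μ * W t x ≤ inner ℝ x (gradient (W t) x)) (u : XSpace α hL) {s : ℝ}
    (hs : 1 ≤ s) : s ^ μ * ∫ t, W t (u.fn t) ≤ ∫ t, W t ((s • u).fn t) := by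
  rw [← integral_const_mul]
  refine integral_mono_ae ((integrable_potential hn hα hα' hW1 hW2 u).const_mul _)
    (integrable_potential hn hα hα' hW1 hW2 (s • u)) ?_
  filter_upwards [Lp.coeFn_smul s u.fn] with t ht
  rw [XSpace.fn_smul, ht]
  exact rpow_mul_le_apply_smul (differentiable_potential hW1.1 t) (hμ t) _ hs

theorem exists_energy_nonpos (hn : 1 ≤ n) (hα : 1 / 2 < α) (hα' : α < 1) (hL : CondL L)
    (hW1 : CondW1 W) (hW2 : CondW2 W) (ρ : ℝ) :
    ∃ e : XSpace α hL, ρ < ‖e‖ ∧ energy hL W e ≤ 0 := by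
  obtain ⟨u, hu⟩ := XSpace.exists_fn_ne_zero hn hα hα' hL
  obtain ⟨μ, hμ2, hμ⟩ := hW1.exists_superquadratic hn
  have hWpos := integral_potential_pos hn hα hα' hW1 hW2 hu
  have hu0 : 0 < ‖u‖ := norm_pos_iff.2 fun h0 => hu (h0 ▸ rfl)
  obtain ⟨s, ⟨hs1, hsρ⟩, hspow⟩ := (((eventually_ge_atTop (1 : ℝ)).and
    (eventually_gt_atTop (ρ / ‖u‖))).and ((tendsto_rpow_atTop (sub_pos.2 hμ2)).eventually
      (eventually_ge_atTop (‖u‖ ^ 2 / ∫ t, W t (u.fn t))))).exists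
  have hs0 : 0 < s := one_pos.trans_le hs1
  have hnorm : ‖s • u‖ = s * ‖u‖ := by rw [norm_smul, Real.norm_of_nonneg hs0.le]
  refine ⟨s • u, by rwa [hnorm, ← div_lt_iff₀ hu0], ?_⟩
  have hlarge : (s * ‖u‖) ^ 2 ≤ ∫ t, W t ((s • u).fn t) := calc
    (s * ‖u‖) ^ 2 = s ^ 2 * ‖u‖ ^ 2 := mul_pow _ _ _
    _ ≤ s ^ 2 * (s ^ (μ - 2) * ∫ t, W t (u.fn t)) := by
        gcongr
        exact (div_le_iff₀ hWpos).1 hspow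
    _ = s ^ μ * ∫ t, W t (u.fn t) := by
        rw [← mul_assoc, ← Real.rpow_two, ← Real.rpow_add hs0, add_sub_cancel]
    _ ≤ ∫ t, W t ((s • u).fn t) := rpow_mul_integral_potential_le hn hα hα' hW1 hW2 hμ u hs1
  rw [energy_eq, hnorm]
  linarith [sq_nonneg (s * ‖u‖)]

end MountainPassGeometry

end FracHam

end

theorem theorem1p1 {n : ℕ} (hn : 1 ≤ n) (α : ℝ) (hα : 1 / 2 < α) (hα' : α < 1)
    (L : ℝ → Matrix (Fin n) (Fin n) ℝ) (hL : FracHam.CondL L)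
    (W : ℝ → FracHam.Vec n → ℝ) (hW1 : FracHam.CondW1 W) (hW2 : FracHam.CondW2 W) :
    (∀ u : FracHam.XSpace α hL, MeasureTheory.Integrable (fun t => W t (u.fn t))) ∧
    ContDiff ℝ 1 (FracHam.energy (α := α) hL W) ∧
    ∃ u : FracHam.XSpace α hL, u.fn ≠ 0 ∧ FracHam.IsWeakSolution W u ∧
      FracHam.IsMountainPassPoint (FracHam.energy hL W) u := by
  refine ⟨FracHam.integrable_potential hn hα hα' hW1 hW2,
    FracHam.contDiff_energy hn hα hα' hW1 hW2, ?_⟩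
  obtain ⟨ρ, hρ, β, hβ, hsphere⟩ := FracHam.exists_sphere_energy_ge (α := α) hn hα hα' hL hW1 hW2
  obtain ⟨e, he, hIe⟩ := FracHam.exists_energy_nonpos (α := α) hn hα hα' hL hW1 hW2 ρ
  obtain ⟨u, hu, hIu, hmp⟩ := FracHam.exists_isMountainPassPoint
    (FracHam.hasGradientAt_energy hn hα hα' hW1 hW2)
    (FracHam.continuous_energyGrad hα hα' hW1.1 hW2)
    (FracHam.palaisSmale_energy hn hα hα' hW1 hW2)
    (FracHam.energy_zero hn hW1) hρ hβ hsphere he hIe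
  exact ⟨u, FracHam.fn_ne_zero_of_energy_pos hn hW1 hu hIu,
    FracHam.isWeakSolution_of_energyGrad_eq_zero hα hα' hW1.1 hW2 hu, hmp⟩
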